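/- Let $\alpha,\beta\in\mathbb C$ with $|\alpha|\ge|\beta|>1$, and fix arguments $\arg\alpha,\arg\beta\in\mathbb R$ (any choice). Let $S^3=\{(\xi_1,\xi_2)\in\mathbb C^2: |\xi_1|^2+|\xi_2|^2=1\}$ and write the points of $S^1\times S^3$ as $(\theta,\xi_1,\xi_2)$ with $\theta\in\mathbb R/2\pi\mathbb Z$. Let $\mathcal E_{\alpha,\beta}$ be the $2$-dimensional foliation of $S^1\times S^3$ tangent to the distribution spanned by the Lee and anti-Lee vector fields $$B=-4\pi\,\partial_\theta+2i(\xi_1\arg\alpha,\ \xi_2\arg\beta),\qquad JB=-2i(\xi_1\log|\alpha|,\ \xi_2\log|\beta|).$$ (Under the identification of $S^1\times S^3$ with the Hopf surface $(\mathbb C^2\setminus 0)/\langle(z_1,z_2)\mapsto(\alpha z_1,\beta z_2)\rangle$ given by $z_1=e^{\theta\log\alpha/2\pi}\xi_1$, $z_2=e^{\theta\log\beta/2\pi}\xi_2$, where $\log\alpha=\log|\alpha|+i\arg\alpha$ and $\log\beta=\log|\beta|+i\arg\beta$, it is generated by the holomorphic vector field $(z_1\log|\alpha|,\,z_2\log|\beta|)$.)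 A flat cubical neighbourhood of a point $p$ is the domain $U$ of a smooth chart $(x,y):U\to\mathbb R^2\times\mathbb R^2$ centred at $p$ whose image is an open cube about the origin, such that the slices $\{y=\text{const}\}$ are tangent to the foliation. Call the foliation quasi-regular if for each point $p$ there are a natural number $N$ and a flat cubical neighbourhood $U$ of $p$ such that every leaf meets $U$ in at most $N$ slices; then let $N(p)$ be the least such $N$. Call it regular if $N(p)=1$ for all $p$. **Theorem.** (1) $\mathcal E_{\alpha,\beta}$ is quasi-regular if and only if $\alpha^m=\beta^n$ for some integers $m,n$ that are not both zero. (2) In that case let $m,n$ be the minimal positive integers with $\alpha^m=\beta^n$ (there is a pair $(m,n)$ of positive integers with $\alpha^m=\beta^n$ such that $m\le m'$ and $n\le n'$ whenever $m',n'$ are positive integers with $\alpha^{m'}=\beta^{n'}$). Then $N(\Theta,\Xi_1,\Xi_2)=1$ if $\Xi_1\Xi_2\ne0$, $N(\Theta,0,\Xi_2)=m$ and $N(\Theta,\Xi_1,0)=n$. Moreover each point $p$ has a flat cubical neighbourhood $U$ such that the leaf through $p$ meets $U$ in one slice and every other leaf that meets $U$ meets it in exactly $N(p)$ slices. (3) $\mathcal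 E_{\alpha,\beta}$ is regular if and only if $\alpha=\beta$. -/

import Mathlib

open scoped Manifold ContDiff

noncomputable section

/-! ### Foliations given by plane distributions -/

section Foliations

variable {E : Type*} [NormedAddCommGroup E] [NormedSpace ℝ E] {H : Type*} [TopologicalSpace H]
  (I : ModelWithCorners ℝ E H) {M : Type*} [TopologicalSpace M] [ChartedSpace H M]

/-- The leaf through `p` of the foliation tangent to the distribution `D`: the points that can be
joined to `p` by a smooth curve which is everywhere tangent to `D`. -/
def foliationLeaf (D : ∀ x : M, Submodule ℝ (TangentSpace I x)) (p : M) : Set M :=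
  {q | ∃ γ : ℝ → M, ContMDiff 𝓘(ℝ, ℝ) I ∞ γ ∧
    (∀ t : ℝ, mfderiv 𝓘(ℝ, ℝ) I γ t (1 : ℝ) ∈ D (γ t)) ∧ γ 0 = p ∧ γ 1 = q}

/-- `φ` is a Frobenius chart centred at `p` (a flat cubical neighbourhood of `p`) for the
`k`-dimensional, `l`-codimensional distribution `D`: a smooth chart with values in `ℝᵏ × ℝˡ`, whose
image is an open cube about the origin (a ball of the sup norm), with `φ p = 0`, and such that `D` is
tangent to the slices `{φ.2 = const}`. -/
structure IsFlatCubicalChart (k l : ℕ) (D : ∀ x : M, Submodule ℝ (TangentSpace I x)) (p : M)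
    (φ : OpenPartialHomeomorph M ((Fin k → ℝ) × (Fin l → ℝ))) : Prop where
  smooth : ContMDiffOn I 𝓘(ℝ, (Fin k → ℝ) × (Fin l → ℝ)) ∞ φ φ.source
  smooth_symm : ContMDiffOn 𝓘(ℝ, (Fin k → ℝ) × (Fin l → ℝ)) I ∞ φ.symm φ.target
  mem_source : p ∈ φ.source
  centered : φ p = 0
  cubical : ∃ r : ℝ, 0 < r ∧ φ.target = Metric.ball 0 r
  flat : ∀ x ∈ φ.source, ∀ v : TangentSpace I x,
    v ∈ D x ↔ mfderiv I 𝓘(ℝ, Fin l → ℝ) (fun y => (φ y).2) x v = (0 : Fin l → ℝ)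

/-- The number of slices `{φ.2 = const}` of the chart `φ` that a set `L` (a leaf) meets. -/
def sliceCount {k l : ℕ} (φ : OpenPartialHomeomorph M ((Fin k → ℝ) × (Fin l → ℝ)))
    (L : Set M) : ℕ∞ :=
  ((fun x => (φ x).2) '' (L ∩ φ.source)).encard

/-- The natural numbers `N` such that `p` has a flat cubical neighbourhood in which every leaf
meets at most `N` slices. -/
def sliceBounds (k l : ℕ) (D : ∀ x : M, Submodule ℝ (TangentSpace I x)) (p : M) : Set ℕ :=
  {N | ∃ φ : OpenPartialHomeomorph M ((Fin k → ℝ) × (Fin l → ℝ)), IsFlatCubicalChart I k l D p φ ∧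
    ∀ q : M, sliceCount φ (foliationLeaf I D q) ≤ N}

/-- `N(p) = N`. -/
def HasMultiplicity (k l : ℕ) (D : ∀ x : M, Submodule ℝ (TangentSpace I x)) (p : M) (N : ℕ) :
    Prop :=
  IsLeast (sliceBounds I k l D p) N

/-- Quasi-regularity: `N(p)` exists at every point. -/
def IsQuasiRegular (k l : ℕ) (D : ∀ x : M, Submodule ℝ (TangentSpace I x)) : Prop :=
  ∀ p : M, ∃ N : ℕ, HasMultiplicity I k l D p N

/-- Regularity: `N(p) = 1` at every point. -/
def IsRegularFoliation (k l : ℕ) (D : ∀ x : M, Submodule ℝ (TangentSpace I x)) : Prop :=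
  ∀ p : M, HasMultiplicity I k l D p 1

/-- `p` has a flat cubical neighbourhood `U` such that the leaf through `p` meets `U` in one slice
and every other leaf that meets `U` meets it in exactly `N` slices. -/
def HasUniformChart (k l : ℕ) (D : ∀ x : M, Submodule ℝ (TangentSpace I x)) (p : M) (N : ℕ) :
    Prop :=
  ∃ φ : OpenPartialHomeomorph M ((Fin k → ℝ) × (Fin l → ℝ)), IsFlatCubicalChart I k l D p φ ∧
    sliceCount φ (foliationLeaf I D p) = 1 ∧
    ∀ q ∈ φ.source, q ∉ foliationLeaf I D p → sliceCount φ (foliationLeaf I D q) = N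

end Foliations

/-! ### The manifold `S¹ × S³` -/

/-- `ℂ²` as a Euclidean space. -/
abbrev C2 : Type := EuclideanSpace ℂ (Fin 2)

instance finrank_real_C2 : Fact (Module.finrank ℝ C2 = 3 + 1) :=
  ⟨by rw [← Module.finrank_mul_finrank ℝ ℂ C2]; simp [Complex.finrank_real_complex]⟩

/-- `S³ = {(ξ₁, ξ₂) ∈ ℂ² : ‖ξ₁‖² + ‖ξ₂‖² = 1}`. -/
abbrev S3 : Type := Metric.sphere (0 : C2) 1

/-- `S¹ × S³`; the point `θ` of `S¹` is `e^{iθ}` in `Circle`. -/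
abbrev S1xS3 : Type := Circle × S3

/-- The model of the smooth manifold `S¹ × S³`. -/
abbrev modelS1xS3 := (𝓡 1).prod (𝓡 3)

/-- The inclusion of `S¹ × S³` in `ℂ × ℂ²`. -/
def inclS1xS3 (x : S1xS3) : ℂ × C2 := ((x.1 : ℂ), (x.2 : C2))

/-! ### The Lee and anti-Lee fields and the foliation `ℰ_{α,β}`

Here `a = log α = log ‖α‖ + i arg α` and `b = log β = log ‖β‖ + i arg β` for any fixed choice of the
arguments.  Vectors tangent to `S¹ × S³` at `(e^{iθ}, ξ)` are written as vectors of `ℂ × ℂ²`. -/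

/-- The Lee field `B = -4π e₁ + 2i (ξ₁ arg α, ξ₂ arg β)`, where `e₁ = ∂/∂θ`. -/
def leeField (a b : ℂ) (x : S1xS3) : ℂ × C2 :=
  (-4 * Real.pi * (Complex.I * (x.1 : ℂ)),
    !₂[2 * Complex.I * (x.2.1 0 * a.im), 2 * Complex.I * (x.2.1 1 * b.im)])

/-- The anti-Lee field `JB = -2i (ξ₁ log ‖α‖, ξ₂ log ‖β‖)`. -/
def antiLeeField (a b : ℂ) (x : S1xS3) : ℂ × C2 :=
  (0, !₂[-2 * Complex.I * (x.2.1 0 * a.re), -2 * Complex.I * (x.2.1 1 * b.re)])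

/-- The coefficient of `e₁` in the tangent vector `X`, that is `dθ (X)`. -/
def dTheta (x : S1xS3) (X : ℂ × C2) : ℝ := ((starRingEnd ℂ) (x.1 : ℂ) * X.1).im

/-- The differential of `F (θ, ξ) = (e^{θa/2π} ξ₁, e^{θb/2π} ξ₂)`, divided by the complex linear map
`diag (e^{θa/2π}, e^{θb/2π})`.  The complex structure `J` of `S¹ × S³` corresponds to
multiplication by `i` on its values. -/
def hopfDifferential (a b : ℂ) (x : S1xS3) (X : ℂ × C2) : ℂ × ℂ :=
  (a * (dTheta x X / (2 * Real.pi) : ℝ) * x.2.1 0 + X.2 0,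
    b * (dTheta x X / (2 * Real.pi) : ℝ) * x.2.1 1 + X.2 1)

/-- `Re G = ‖ξ₁‖² log ‖α‖ + ‖ξ₂‖² log ‖β‖`. -/
def reG (a b : ℂ) (x : S1xS3) : ℝ :=
  Complex.normSq (x.2.1 0) * a.re + Complex.normSq (x.2.1 1) * b.re

/-- The coefficients of `X` in the complex basis `e₂ = (iξ₁, iξ₂)`, `e₃ = (-ξ̄₂, ξ̄₁)`. -/
def complexCoeffs (a b : ℂ) (x : S1xS3) (X : ℂ × C2) : ℂ × ℂ :=
  (-Complex.I * ((starRingEnd ℂ) (x.2.1 0) * (hopfDifferential a b x X).1 +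
      (starRingEnd ℂ) (x.2.1 1) * (hopfDifferential a b x X).2),
    -x.2.1 1 * (hopfDifferential a b x X).1 + x.2.1 0 * (hopfDifferential a b x X).2)

/-- The locally conformal Kähler metric `g^h` at `x`, where `h` is the value at `x` of the positive
function on `S¹` on which it depends: the real part of the hermitian form with its matrix in the
complex basis `(e₂, e₃)`. -/
def lckMetric (a b : ℂ) (h : ℝ) (x : S1xS3) (X Y : ℂ × C2) : ℝ :=
  let R : ℝ := reG a b x
  let d : ℝ := a.re - b.re
  let u := complexCoeffs a b x X
  let v := complexCoeffs a b x Y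
  let M₂₂ : ℝ := Real.pi * h / R ^ 2 +
    Complex.normSq (x.2.1 0) * Complex.normSq (x.2.1 1) * d ^ 2 / R ^ 3
  let M₂₃ : ℂ := Complex.I * x.2.1 0 * x.2.1 1 * d / R ^ 2
  let M₃₃ : ℝ := 1 / R
  (M₂₂ * u.1 * (starRingEnd ℂ) v.1 + M₂₃ * u.1 * (starRingEnd ℂ) v.2 +
    (starRingEnd ℂ) M₂₃ * u.2 * (starRingEnd ℂ) v.1 + M₃₃ * u.2 * (starRingEnd ℂ) v.2).re

lemma S3_normSq (x : S1xS3) :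
    Complex.normSq (x.2.1 0) + Complex.normSq (x.2.1 1) = 1 := by
  have h := EuclideanSpace.norm_sq_eq x.2.1
  rw [mem_sphere_zero_iff_norm.1 x.2.2] at h
  simp only [Fin.sum_univ_two, ← Complex.normSq_eq_norm_sq] at h
  linarith

lemma dTheta_leeField (a b : ℂ) (x : S1xS3) : dTheta x (leeField a b x) = -4 * Real.pi := by
  have h : (starRingEnd ℂ) (x.1 : ℂ) * (x.1 : ℂ) = 1 := by
    rw [← Complex.normSq_eq_conj_mul_self, Circle.normSq_coe]; simp
  have : (starRingEnd ℂ) (x.1 : ℂ) * (leeField a b x).1 =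
      (((-4 * Real.pi : ℝ) : ℂ)) * Complex.I := by
    simp only [leeField]; push_cast; linear_combination (-4 * Real.pi * Complex.I) * h
  rw [dTheta, this]; simp

lemma hopfDifferential_leeField (a b : ℂ) (x : S1xS3) :
    hopfDifferential a b x (leeField a b x) = (-2 * (x.2.1 0 * a.re), -2 * (x.2.1 1 * b.re)) := by
  have hpi := Real.pi_ne_zero
  have e : -4 * Real.pi / (2 * Real.pi) = (-2 : ℝ) := by field_simp; norm_num
  simp only [hopfDifferential, dTheta_leeField, e]
  simp only [leeField]
  ext1
  · simp; linear_combination (-2 * x.2.1 0) * (Complex.re_add_im a).symm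
  · simp; linear_combination (-2 * x.2.1 1) * (Complex.re_add_im b).symm

/-- `JB` is the image of `B` under the complex structure. -/
lemma hopfDifferential_antiLeeField (a b : ℂ) (x : S1xS3) :
    hopfDifferential a b x (antiLeeField a b x) =
      Complex.I • hopfDifferential a b x (leeField a b x) := by
  rw [hopfDifferential_leeField]
  simp only [hopfDifferential, dTheta, antiLeeField]
  ext1 <;> simp <;> ring

/-- `B` is the dual with respect to `g^h` of the Lee form `ω = -h e¹` of `g^h`. -/
lemma lckMetric_leeField (a b : ℂ) (ha : 0 < a.re) (hb : 0 < b.re) (h : ℝ) (x : S1xS3)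
    (X : ℂ × C2)
    (hX : ((starRingEnd ℂ) (x.2.1 0) * X.2 0 + (starRingEnd ℂ) (x.2.1 1) * X.2 1).re = 0) :
    lckMetric a b h x (leeField a b x) X = -h * dTheta x X := by
  have hS := S3_normSq x
  have hR : reG a b x ≠ 0 := by
    have h0 := Complex.normSq_nonneg (x.2.1 0)
    have h1 := Complex.normSq_nonneg (x.2.1 1)
    unfold reG
    rcases h0.lt_or_eq with h0 | h0
    · positivity
    · have : Complex.normSq (x.2.1 1) = 1 := by linarith
      rw [← h0, this]; linarith
  have hRC : (reG a b x : ℂ) ≠ 0 := by exact_mod_cast hR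
  have hpi := Real.pi_ne_zero
  have n0 := Complex.mul_conj (x.2.1 0)
  have n1 := Complex.mul_conj (x.2.1 1)
  have u2 : (complexCoeffs a b x (leeField a b x)).1 = 2 * Complex.I * reG a b x := by
    simp only [complexCoeffs, hopfDifferential_leeField, reG]
    push_cast
    linear_combination (2 * Complex.I * a.re) * n0 + (2 * Complex.I * b.re) * n1
  have u3 : (complexCoeffs a b x (leeField a b x)).2 =
      2 * (x.2.1 0 * x.2.1 1) * (a.re - b.re : ℝ) := by
    simp only [complexCoeffs, hopfDifferential_leeField]
    push_cast
    ring
  have v2 : (complexCoeffs a b x X).1.im = -(dTheta x X * reG a b x / (2 * Real.pi)) := by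
    simp only [complexCoeffs, hopfDifferential, reG]
    rw [mul_div_right_comm]
    generalize dTheta x X / (2 * Real.pi) = τ
    simp only [Complex.add_re, Complex.mul_re, Complex.conj_re, Complex.conj_im] at hX
    simp only [Complex.mul_im, Complex.mul_re, Complex.add_re, Complex.add_im, Complex.neg_re,
      Complex.neg_im, Complex.I_re, Complex.I_im, Complex.conj_re, Complex.conj_im,
      Complex.ofReal_re, Complex.ofReal_im, Complex.normSq_apply]
    linear_combination -hX
  have key : ∀ v : ℂ × ℂ, v = complexCoeffs a b x X →
      lckMetric a b h x (leeField a b x) X =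
        (((2 * Real.pi * h / reG a b x : ℝ) : ℂ) * (Complex.I * (starRingEnd ℂ) v.1)).re := by
    rintro v rfl
    simp only [lckMetric, u2, u3]
    congr 1
    simp only [map_mul, map_div₀, map_pow, Complex.conj_I, Complex.conj_ofReal]
    push_cast
    rw [← n0, ← n1]
    field_simp
    ring_nf
    simp only [Complex.I_sq]
    ring
  rw [key _ rfl, Complex.re_ofReal_mul]
  simp [v2]
  field_simp

/-- The distribution tangent to `ℰ_{α,β}`: the vectors tangent to `S¹ × S³` that lie in the plane
spanned by `B` and `JB`. -/
def canonicalDistribution (a b : ℂ) (x : S1xS3) : Submodule ℝ (TangentSpace modelS1xS3 x) :=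
  (Submodule.span ℝ {leeField a b x, antiLeeField a b x}).comap
    (mfderiv modelS1xS3 𝓘(ℝ, ℂ × C2) inclS1xS3 x).toLinearMap

end

/-! The fields `B` and `JB` commute and integrate to the explicit action of ℝ² on `S¹ × S³` that
shifts θ by `-4πs` and multiplies `ξ_k` by `e^{2i(s Im c_k - t Re c_k)}`, where `c = (a, b)` are the
chosen logarithms. The leaves are the orbits of this action (`mem_foliationLeaf_iff`).

Where `ξ_i ≠ 0`, fixing θ and the argument of `ξ_i` cuts out a transversal with coordinate `w = ξ_j
/ |ξ_i|`, and `(s, t, w)` are flow box coordinates. An orbit returns to the transversal exactly when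
`e^{-4πis} = 1` and the phase of `ξ_i` is 1; the return map multiplies `w` by the phase of `ξ_j`.
These phases form a subgroup `H` of the circle, `holonomy (c i) (c j)`, and the slices met by a leaf
are the points of an `H`-orbit inside a disk (`sliceCount_eq_encard`).

About `w = 0` a round disk is invariant under `H`, so every leaf but the central one meets `|H|`
slices. No chart does better: in any flat chart the transverse coordinate restricts to a local
diffeomorphism on the transversal, so it separates the points of a small orbit
(`encard_holonomy_le`). About `w ≠ 0` a finite `H` acts freely, and a small disk contains at most
one point of each orbit.

It remains to compute `H`. If it is finite, two of its elements have finite order, and this amounts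
to a relation between powers of `α` and `β` (`exists_pow_eq_pow_of_finite_holonomy`). Conversely, a
minimal relation lifts to `m w = n z + 2πil` between logarithms with `gcd(m, n, l) = 1`, and
Bézout's identity gives that `H` is the group of `m`-th roots of unity (`holonomy_eq`). Regularity
then means `m = n = 1`, that is `α = β`. -/

noncomputable section

/-! ### The action of ℝ² generated by the Lee and anti-Lee fields -/

/-- `e^{2i(s Im z - t Re z)}`, the factor by which the flow of `sB + tJB` multiplies a coordinate of
`ℂ²` with weight `z`. -/
def phase (z : ℂ) (s t : ℝ) : Circle := Circle.exp (2 * (s * z.im - t * z.re))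

lemma phase_zero (z : ℂ) : phase z 0 0 = 1 := by simp [phase]

lemma phase_add (z : ℂ) (s t s' t' : ℝ) :
    phase z (s + s') (t + t') = phase z s t * phase z s' t' := by
  rw [phase, phase, phase, ← Circle.exp_add]; ring_nf

lemma S1xS3_ext {x y : S1xS3} (h : x.1 = y.1) (h' : ∀ k, x.2.1 k = y.2.1 k) : x = y :=
  Prod.ext h (Subtype.ext (PiLp.ext h'))

/-- The time-one flow of `sB + tJB`. -/
def hopfFlow (c : Fin 2 → ℂ) (s t : ℝ) (x : S1xS3) : S1xS3 :=
  (Circle.exp (-4 * Real.pi * s) * x.1,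
    ⟨WithLp.toLp 2 fun k => (phase (c k) s t : ℂ) * x.2.1 k, by
      rw [mem_sphere_zero_iff_norm, ← sq_eq_sq₀ (norm_nonneg _) zero_le_one,
        EuclideanSpace.norm_sq_eq]
      have := EuclideanSpace.norm_sq_eq x.2.1
      rw [mem_sphere_zero_iff_norm.1 x.2.2] at this
      simpa only [norm_mul, Circle.norm_coe, one_mul, one_pow] using this.symm⟩)

lemma hopfFlow_fst (c : Fin 2 → ℂ) (s t : ℝ) (x : S1xS3) :
    (hopfFlow c s t x).1 = Circle.exp (-4 * Real.pi * s) * x.1 := rfl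

lemma hopfFlow_snd (c : Fin 2 → ℂ) (s t : ℝ) (x : S1xS3) (k : Fin 2) :
    (hopfFlow c s t x).2.1 k = phase (c k) s t * x.2.1 k := rfl

lemma hopfFlow_zero (c : Fin 2 → ℂ) (x : S1xS3) : hopfFlow c 0 0 x = x :=
  S1xS3_ext (by simp [hopfFlow_fst]) fun k => by simp [hopfFlow_snd, phase_zero]

lemma hopfFlow_add (c : Fin 2 → ℂ) (s t s' t' : ℝ) (x : S1xS3) :
    hopfFlow c (s + s') (t + t') x = hopfFlow c s t (hopfFlow c s' t' x) :=
  S1xS3_ext (by simp only [hopfFlow_fst, ← mul_assoc, ← Circle.exp_add]; ring_nf) fun k => by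
    simp [hopfFlow_snd, phase_add, mul_assoc]

/-! ### Calculus on `S¹ × S³` through its embedding in `ℂ × ℂ²` -/

lemma contMDiff_inclS1xS3 : ContMDiff modelS1xS3 𝓘(ℝ, ℂ × C2) ∞ inclS1xS3 := by
  have := finrank_real_complex_fact'
  have h1 : ContMDiff (𝓡 1) 𝓘(ℝ, ℂ) ∞ (fun z : Circle => (z : ℂ)) :=
    contMDiff_coe_sphere (E := ℂ) (n := 1)
  have h2 : ContMDiff (𝓡 3) 𝓘(ℝ, C2) ∞ ((↑) : S3 → C2) := contMDiff_coe_sphere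
  exact (h1.comp contMDiff_fst).prodMk_space (h2.comp contMDiff_snd)

/-- A smooth map to the ambient space with values in a sphere is smooth into the sphere. This allows
smoothness to be checked in ambient coordinates. -/
lemma contMDiff_of_inclS1xS3 {F : Type*} [NormedAddCommGroup F] [NormedSpace ℝ F]
    {f : F → S1xS3} (hf : ContDiff ℝ ∞ (inclS1xS3 ∘ f)) :
    ContMDiff 𝓘(ℝ, F) modelS1xS3 ∞ f := by
  have := finrank_real_complex_fact'
  have h1 : ContMDiff 𝓘(ℝ, F) (𝓡 1) ∞ fun x => (f x).1 := by
    have : ContMDiff 𝓘(ℝ, F) 𝓘(ℝ, ℂ) ∞ fun x => ((f x).1 : ℂ) := hf.fst.contMDiff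
    exact this.codRestrict_sphere (E := ℂ) (n := 1) fun x => by
      rw [mem_sphere_zero_iff_norm]; exact Circle.norm_coe _
  have h2 : ContMDiff 𝓘(ℝ, F) (𝓡 3) ∞ fun x => (f x).2 := by
    have : ContMDiff 𝓘(ℝ, F) 𝓘(ℝ, C2) ∞ fun x => ((f x).2 : C2) := hf.snd.contMDiff
    exact this.codRestrict_sphere fun x => (f x).2.2
  exact h1.prodMk h2

lemma mdifferentiableAt_inclS1xS3 (x : S1xS3) :
    MDifferentiableAt modelS1xS3 𝓘(ℝ, ℂ × C2) inclS1xS3 x :=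
  contMDiff_inclS1xS3.mdifferentiableAt (by simp)

lemma hasDerivAt_phase (z : ℂ) {s t : ℝ → ℝ} {s' t' τ : ℝ} (hs : HasDerivAt s s' τ)
    (ht : HasDerivAt t t' τ) :
    HasDerivAt (fun τ => (phase z (s τ) (t τ) : ℂ))
      (2 * Complex.I * (s' * z.im - t' * z.re) * phase z (s τ) (t τ)) τ := by
  have h : HasDerivAt (fun τ => ((2 * (s τ * z.im - t τ * z.re) : ℝ) : ℂ) * Complex.I)
      (((2 * (s' * z.im - t' * z.re) : ℝ) : ℂ) * Complex.I) τ :=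
    ((((hs.mul_const _).sub (ht.mul_const _)).const_mul 2).ofReal_comp).mul_const _
  have := h.cexp
  simp only [phase, Circle.coe_exp]
  convert this using 1
  push_cast; ring

lemma hasDerivAt_circleExp {s : ℝ → ℝ} {s' τ : ℝ} (k : ℝ) (hs : HasDerivAt s s' τ) :
    HasDerivAt (fun τ => (Circle.exp (k * s τ) : ℂ))
      (k * s' * Complex.I * Circle.exp (k * s τ)) τ := by
  have h : HasDerivAt (fun τ => ((k * s τ : ℝ) : ℂ) * Complex.I)
      (((k * s' : ℝ) : ℂ) * Complex.I) τ :=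
    ((hs.const_mul k).ofReal_comp).mul_const _
  have := h.cexp
  simp only [Circle.coe_exp]
  convert this using 1
  push_cast; ring

lemma C2_hasDerivAt_iff {f : ℝ → C2} {f' : C2} {τ : ℝ} :
    HasDerivAt f f' τ ↔ ∀ k, HasDerivAt (fun τ => f τ k) (f' k) τ := by
  let e : C2 ≃L[ℝ] (Fin 2 → ℂ) := PiLp.continuousLinearEquiv 2 ℝ fun _ => ℂ
  rw [← hasDerivAt_pi]
  exact ⟨fun h => e.hasFDerivAt.comp_hasDerivAt τ h,
    fun h => e.symm.hasFDerivAt.comp_hasDerivAt τ h⟩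

lemma leeField_snd (c : Fin 2 → ℂ) (x : S1xS3) (k : Fin 2) :
    (leeField (c 0) (c 1) x).2 k = 2 * Complex.I * (x.2.1 k * (c k).im) := by
  revert k; simp [Fin.forall_fin_two, leeField]

lemma antiLeeField_snd (c : Fin 2 → ℂ) (x : S1xS3) (k : Fin 2) :
    (antiLeeField (c 0) (c 1) x).2 k = -2 * Complex.I * (x.2.1 k * (c k).re) := by
  revert k; simp [Fin.forall_fin_two, antiLeeField]

/-- The times `s` and `t` vary along a curve, so that one formula serves both for curves in a leaf
and for lines in a slice of a flow box. -/
lemma hasDerivAt_hopfFlow (c : Fin 2 → ℂ) (x : S1xS3) {s t : ℝ → ℝ} {s' t' τ : ℝ}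
    (hs : HasDerivAt s s' τ) (ht : HasDerivAt t t' τ) :
    HasDerivAt (fun τ => inclS1xS3 (hopfFlow c (s τ) (t τ) x))
      (s' • leeField (c 0) (c 1) (hopfFlow c (s τ) (t τ) x) +
        t' • antiLeeField (c 0) (c 1) (hopfFlow c (s τ) (t τ) x)) τ := by
  set X := s' • leeField (c 0) (c 1) (hopfFlow c (s τ) (t τ) x) +
        t' • antiLeeField (c 0) (c 1) (hopfFlow c (s τ) (t τ) x) with hX
  have h1 : HasDerivAt (fun τ => ((hopfFlow c (s τ) (t τ) x).1 : ℂ)) X.1 τ := by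
    refine ((hasDerivAt_circleExp (-4 * Real.pi) hs).mul_const (x.1 : ℂ)).congr_deriv ?_
    simp only [hX, Prod.fst_add, Prod.smul_fst, leeField, antiLeeField, hopfFlow_fst,
      Complex.real_smul, Circle.coe_mul]
    push_cast
    ring
  have h2 : HasDerivAt (fun τ => ((hopfFlow c (s τ) (t τ) x).2 : C2)) X.2 τ := by
    refine C2_hasDerivAt_iff.2 fun k => ?_
    refine ((hasDerivAt_phase (c k) hs ht).mul_const (x.2.1 k)).congr_deriv ?_
    simp only [hX, Prod.snd_add, Prod.smul_snd, PiLp.add_apply, PiLp.smul_apply, leeField_snd,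
      antiLeeField_snd, hopfFlow_snd, Complex.real_smul]
    ring
  exact h1.prodMk h2

lemma mem_canonicalDistribution {a b : ℂ} {x : S1xS3} {v : TangentSpace modelS1xS3 x} :
    v ∈ canonicalDistribution a b x ↔ ∃ σ τ : ℝ, σ • leeField a b x + τ • antiLeeField a b x =
      mfderiv modelS1xS3 𝓘(ℝ, ℂ × C2) inclS1xS3 x v := by
  exact Submodule.mem_span_pair (R := ℝ) (M := ℂ × C2)

lemma mfderiv_inclS1xS3_comp {F : Type*} [NormedAddCommGroup F] [NormedSpace ℝ F]
    {f : F → S1xS3} {x : F} (hf : MDifferentiableAt 𝓘(ℝ, F) modelS1xS3 f x) (v : F) :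
    mfderiv modelS1xS3 𝓘(ℝ, ℂ × C2) inclS1xS3 (f x) (mfderiv 𝓘(ℝ, F) modelS1xS3 f x v) =
      fderiv ℝ (inclS1xS3 ∘ f) x v := by
  rw [← mfderiv_eq_fderiv]
  exact (mfderiv_comp_apply x (mdifferentiableAt_inclS1xS3 (f x)) hf v).symm

lemma contDiff_phase {F : Type*} [NormedAddCommGroup F] [NormedSpace ℝ F] (z : ℂ) {s t : F → ℝ}
    (hs : ContDiff ℝ ∞ s) (ht : ContDiff ℝ ∞ t) :
    ContDiff ℝ ∞ fun x => (phase z (s x) (t x) : ℂ) := by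
  simp only [phase, Circle.coe_exp]
  have := Complex.ofRealCLM.contDiff (n := ∞)
  have h2 : ContDiff ℝ ∞ fun x => 2 * (s x * z.im - t x * z.re) := by fun_prop
  exact ((this.comp h2).mul contDiff_const).cexp

lemma contDiff_hopfFlow {F : Type*} [NormedAddCommGroup F] [NormedSpace ℝ F] (c : Fin 2 → ℂ)
    {s t : F → ℝ} {f : F → S1xS3} (hs : ContDiff ℝ ∞ s) (ht : ContDiff ℝ ∞ t)
    (hf : ContDiff ℝ ∞ (inclS1xS3 ∘ f)) :
    ContDiff ℝ ∞ (inclS1xS3 ∘ fun x => hopfFlow c (s x) (t x) (f x)) := by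
  refine ContDiff.prodMk ?_ ((contDiff_piLp 2).2 fun k => ?_)
  · have h1 : ContDiff ℝ ∞ fun x => -4 * Real.pi * s x := by fun_prop
    have := ((Complex.ofRealCLM.contDiff (n := ∞)).comp h1).mul
      (contDiff_const (c := Complex.I))
    exact this.cexp.mul hf.fst
  · exact (contDiff_phase (c k) hs ht).mul ((contDiff_piLp 2).1 hf.snd k)

/-! ### Leaves are orbits -/

lemma hopfFlow_mem_foliationLeaf (c : Fin 2 → ℂ) (s t : ℝ) (p : S1xS3) :
    hopfFlow c s t p ∈ foliationLeaf modelS1xS3 (canonicalDistribution (c 0) (c 1)) p := by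
  have hγ : ContMDiff 𝓘(ℝ, ℝ) modelS1xS3 ∞ fun τ : ℝ => hopfFlow c (τ * s) (τ * t) p :=
    contMDiff_of_inclS1xS3 <| contDiff_hopfFlow c (by fun_prop) (by fun_prop) contDiff_const
  refine ⟨_, hγ, fun τ => mem_canonicalDistribution.2 ⟨s, t, ?_⟩, by simp [hopfFlow_zero], by simp⟩
  rw [mfderiv_inclS1xS3_comp (hγ.mdifferentiableAt (by simp)), fderiv_apply_one_eq_deriv]
  have := hasDerivAt_hopfFlow c p (hasDerivAt_mul_const (x := τ) s) (hasDerivAt_mul_const (x := τ) t)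
  exact this.deriv.symm

/-- A curve tangent to the distribution moves along the flow. -/
lemma exists_hopfFlow_of_mem_foliationLeaf {c : Fin 2 → ℂ} (hc : ∀ k, 0 < (c k).re) {p q : S1xS3}
    (hq : q ∈ foliationLeaf modelS1xS3 (canonicalDistribution (c 0) (c 1)) p) :
    ∃ s t : ℝ, q = hopfFlow c s t p := by
  obtain ⟨γ, hγ, hD, rfl, rfl⟩ := hq
  have hg : ContDiff ℝ ∞ (inclS1xS3 ∘ γ) := (contMDiff_inclS1xS3.comp hγ).contDiff
  have hg' : ∀ τ, HasDerivAt (inclS1xS3 ∘ γ) (deriv (inclS1xS3 ∘ γ) τ) τ := fun τ =>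
    (hg.differentiable (by simp) τ).hasDerivAt
  have hcont : Continuous (deriv (inclS1xS3 ∘ γ)) := hg.continuous_deriv (by simp)
  have hγc : Continuous (inclS1xS3 ∘ γ) := hg.continuous
  set X := deriv (inclS1xS3 ∘ γ) with hX
  have hspan : ∀ τ, ∃ u v : ℝ, u • leeField (c 0) (c 1) (γ τ) +
      v • antiLeeField (c 0) (c 1) (γ τ) = X τ := fun τ => by
    obtain ⟨u, v, h⟩ := mem_canonicalDistribution.1 (hD τ)
    refine ⟨u, v, h.trans ?_⟩
    rw [mfderiv_inclS1xS3_comp (hγ.mdifferentiableAt (by simp)), fderiv_apply_one_eq_deriv]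
  choose u v huv using hspan
  have hz : ∀ τ, (starRingEnd ℂ) ((γ τ).1 : ℂ) * ((γ τ).1 : ℂ) = 1 := fun τ => by
    rw [← Complex.normSq_eq_conj_mul_self, Circle.normSq_coe]; simp
  have hX1 : ∀ τ, (X τ).1 = -4 * Real.pi * u τ * Complex.I * (γ τ).1 := fun τ => by
    rw [← huv]
    simp only [Prod.fst_add, Prod.smul_fst, leeField, antiLeeField, Complex.real_smul]
    ring
  have hX2 : ∀ τ k, (X τ).2 k =
      2 * Complex.I * (u τ * (c k).im - v τ * (c k).re) * (γ τ).2.1 k := fun τ k => by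
    rw [← huv]
    simp only [Prod.snd_add, Prod.smul_snd, PiLp.add_apply, PiLp.smul_apply, leeField_snd,
      antiLeeField_snd, Complex.real_smul]
    ring
  have hc1 : Continuous fun τ => ((γ τ).1 : ℂ) := hγc.fst
  have hc2 : ∀ k, Continuous fun τ => (γ τ).2.1 k := fun k =>
    (EuclideanSpace.proj (𝕜 := ℂ) k).continuous.comp hγc.snd
  have hX2c : ∀ k, Continuous fun τ => (X τ).2 k := fun k =>
    (EuclideanSpace.proj (𝕜 := ℂ) k).continuous.comp hcont.snd
  have hu : Continuous u := by
    -- The coefficients were merely chosen, so their continuity has to be read off from explicit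
    -- formulas. Only `B` has a component along the circle, which determines `u`.
    have : u = fun τ => -((starRingEnd ℂ) ((γ τ).1 : ℂ) * (X τ).1).im / (4 * Real.pi) := by
      ext τ
      have : (starRingEnd ℂ) ((γ τ).1 : ℂ) * (X τ).1 =
          ((-4 * Real.pi * u τ : ℝ) : ℂ) * Complex.I := by
        rw [hX1]; push_cast; linear_combination (-4 * Real.pi * u τ * Complex.I) * hz τ
      rw [this, Complex.im_ofReal_mul]
      field_simp
      simp
    rw [this]
    exact (Complex.continuous_im.comp
      ((Complex.continuous_conj.comp hc1).mul hcont.fst)).neg.div_const _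
  have hR : ∀ τ, reG (c 0) (c 1) (γ τ) ≠ 0 := fun τ => by
    have hS := S3_normSq (γ τ)
    have h0 := Complex.normSq_nonneg ((γ τ).2.1 0)
    have h1 := Complex.normSq_nonneg ((γ τ).2.1 1)
    have c0 := hc 0
    have c1 := hc 1
    unfold reG
    rcases h0.lt_or_eq with h0 | h0
    · positivity
    · rw [← h0] at hS ⊢
      rw [zero_add] at hS
      rw [hS]; linarith
  have hv : Continuous v := by
    -- The Hermitian product of `ξ` with the `ℂ²` part of the velocity is `2i` times a real number
    -- in which `v` has the coefficient `-reG`; as `reG` does not vanish, the equation can be solved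
    -- for `v`.
    have : v = fun τ => (u τ * (Complex.normSq ((γ τ).2.1 0) * (c 0).im +
        Complex.normSq ((γ τ).2.1 1) * (c 1).im) -
        ((starRingEnd ℂ) ((γ τ).2.1 0) * (X τ).2 0 +
          (starRingEnd ℂ) ((γ τ).2.1 1) * (X τ).2 1).im / 2) / reG (c 0) (c 1) (γ τ) := by
      ext τ
      rw [eq_div_iff (hR τ), hX2, hX2, reG]
      have key : ∀ k, (starRingEnd ℂ) ((γ τ).2.1 k) * (2 * Complex.I *
          (u τ * (c k).im - v τ * (c k).re) * (γ τ).2.1 k) =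
          ((2 * (u τ * (c k).im - v τ * (c k).re) * Complex.normSq ((γ τ).2.1 k) : ℝ) : ℂ) *
            Complex.I := fun k => by
        push_cast
        linear_combination (2 * Complex.I * (u τ * (c k).im - v τ * (c k).re)) *
          (Complex.mul_conj ((γ τ).2.1 k))
      rw [key, key, Complex.add_im, Complex.im_ofReal_mul, Complex.im_ofReal_mul, Complex.I_im]
      ring
    rw [this]
    have hn : ∀ k, Continuous fun τ => Complex.normSq ((γ τ).2.1 k) := fun k =>
      Complex.continuous_normSq.comp (hc2 k)
    have hm : ∀ k, Continuous fun τ => (starRingEnd ℂ) ((γ τ).2.1 k) * (X τ).2 k := fun k =>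
      (Complex.continuous_conj.comp (hc2 k)).mul (hX2c k)
    refine Continuous.div (Continuous.sub (hu.mul (((hn 0).mul continuous_const).add
      ((hn 1).mul continuous_const))) ((Complex.continuous_im.comp
        ((hm 0).add (hm 1))).div_const 2)) ?_ hR
    exact ((hn 0).mul continuous_const).add ((hn 1).mul continuous_const)
  set S : ℝ → ℝ := fun τ => ∫ r in (0 : ℝ)..τ, u r with hSdef
  set T : ℝ → ℝ := fun τ => ∫ r in (0 : ℝ)..τ, v r with hTdef
  have hS : ∀ τ, HasDerivAt S (u τ) τ := fun τ => hu.integral_hasStrictDerivAt 0 τ |>.hasDerivAt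
  have hT : ∀ τ, HasDerivAt T (v τ) τ := fun τ => hv.integral_hasStrictDerivAt 0 τ |>.hasDerivAt
  have hS0 : S 0 = 0 := intervalIntegral.integral_same
  have hT0 : T 0 = 0 := intervalIntegral.integral_same
  -- Flowing `γ τ` back by the integrals of `u` and `v` gives a curve whose ambient coordinates have
  -- zero derivative, so it stays at `γ 0`.
  have key : hopfFlow c (-S 1) (-T 1) (γ 1) = γ 0 := by
    have e0 : hopfFlow c (-S 0) (-T 0) (γ 0) = γ 0 := by simp [hS0, hT0, hopfFlow_zero]
    refine Eq.trans ?_ e0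
    refine S1xS3_ext (Subtype.ext ?_) fun k => ?_
    · refine is_const_of_deriv_eq_zero
        (f := fun τ => ((hopfFlow c (-S τ) (-T τ) (γ τ)).1 : ℂ)) ?_ ?_ 1 0
      all_goals
        have hd : ∀ τ, HasDerivAt (fun τ => ((hopfFlow c (-S τ) (-T τ) (γ τ)).1 : ℂ)) 0 τ := by
          intro τ
          have h1 : HasDerivAt (fun τ => ((γ τ).1 : ℂ)) (X τ).1 τ := (hg' τ).fst
          refine ((hasDerivAt_circleExp (-4 * Real.pi) (hS τ).neg).mul h1).congr_deriv ?_
          rw [hX1]; push_cast; ring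
      · exact fun τ => (hd τ).differentiableAt
      · exact fun τ => (hd τ).deriv
    · refine is_const_of_deriv_eq_zero
        (f := fun τ => (hopfFlow c (-S τ) (-T τ) (γ τ)).2.1 k) ?_ ?_ 1 0
      all_goals
        have hd : ∀ τ, HasDerivAt (fun τ => (hopfFlow c (-S τ) (-T τ) (γ τ)).2.1 k) 0 τ := by
          intro τ
          have h1 : HasDerivAt (fun τ => (γ τ).2.1 k) ((X τ).2 k) τ :=
            C2_hasDerivAt_iff.1 (hg' τ).snd k
          refine ((hasDerivAt_phase (c k) (hS τ).neg (hT τ).neg).mul h1).congr_deriv ?_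
          rw [hX2]; push_cast; ring
      · exact fun τ => (hd τ).differentiableAt
      · exact fun τ => (hd τ).deriv
  refine ⟨S 1, T 1, ?_⟩
  rw [← key, ← hopfFlow_add]
  simp [hopfFlow_zero]

lemma mem_foliationLeaf_iff {c : Fin 2 → ℂ} (hc : ∀ k, 0 < (c k).re) {p q : S1xS3} :
    q ∈ foliationLeaf modelS1xS3 (canonicalDistribution (c 0) (c 1)) p ↔
      ∃ s t : ℝ, q = hopfFlow c s t p :=
  ⟨exists_hopfFlow_of_mem_foliationLeaf hc, by
    rintro ⟨s, t, rfl⟩; exact hopfFlow_mem_foliationLeaf c s t p⟩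

lemma foliationLeaf_eq_of_mem {c : Fin 2 → ℂ} (hc : ∀ k, 0 < (c k).re) {p q : S1xS3}
    (h : q ∈ foliationLeaf modelS1xS3 (canonicalDistribution (c 0) (c 1)) p) :
    foliationLeaf modelS1xS3 (canonicalDistribution (c 0) (c 1)) q =
      foliationLeaf modelS1xS3 (canonicalDistribution (c 0) (c 1)) p := by
  obtain ⟨s, t, rfl⟩ := (mem_foliationLeaf_iff hc).1 h
  ext x
  rw [mem_foliationLeaf_iff hc, mem_foliationLeaf_iff hc]
  constructor
  · rintro ⟨s', t', rfl⟩
    exact ⟨s' + s, t' + t, (hopfFlow_add ..).symm⟩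
  · rintro ⟨s', t', rfl⟩
    exact ⟨s' - s, t' - t, by rw [← hopfFlow_add]; simp⟩

lemma mem_foliationLeaf_self (c : Fin 2 → ℂ) (p : S1xS3) :
    p ∈ foliationLeaf modelS1xS3 (canonicalDistribution (c 0) (c 1)) p := by
  simpa only [hopfFlow_zero] using hopfFlow_mem_foliationLeaf c 0 0 p

/-! ### Transversals -/

lemma fin_two_eq_of_ne {i j k : Fin 2} (hij : i ≠ j) (hk : k ≠ i) : k = j := by
  revert i j k; decide

lemma fin_two_exists_ne (i : Fin 2) : ∃ j, i ≠ j := by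
  revert i; decide

/-- The point `(w, u) / √(1 + ‖w‖²)` of `S³`, where `u` is the coordinate with index `i`. -/
def spherePoint (i : Fin 2) (u : Circle) (w : ℂ) : S3 :=
  ⟨WithLp.toLp 2 fun k => (((√(1 + ‖w‖ ^ 2))⁻¹ : ℝ) : ℂ) * if k = i then (u : ℂ) else w, by
    have h : 0 < 1 + ‖w‖ ^ 2 := by positivity
    rw [mem_sphere_zero_iff_norm, ← sq_eq_sq₀ (norm_nonneg _) zero_le_one,
      EuclideanSpace.norm_sq_eq]
    revert i
    simp only [Fin.forall_fin_two, Fin.sum_univ_two, norm_mul, mul_pow, Complex.norm_real,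
      Real.norm_eq_abs, sq_abs, inv_pow, Real.sq_sqrt h.le]
    constructor <;> simp [Circle.norm_coe] <;> field_simp
    ring⟩

/-- A surface transverse to the foliation. -/
def transversal (i : Fin 2) (Θ u : Circle) (w : ℂ) : S1xS3 := (Θ, spherePoint i u w)

lemma transversal_snd (i : Fin 2) (Θ u : Circle) (w : ℂ) (k : Fin 2) :
    (transversal i Θ u w).2.1 k = (((√(1 + ‖w‖ ^ 2))⁻¹ : ℝ) : ℂ) * if k = i then (u : ℂ) else w :=
  rfl

lemma contDiff_sqrt_inv : ContDiff ℝ ∞ fun w : ℂ => (((√(1 + ‖w‖ ^ 2))⁻¹ : ℝ) : ℂ) := by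
  have h : ContDiff ℝ ∞ fun w : ℂ => (√(1 + ‖w‖ ^ 2))⁻¹ :=
    ((contDiff_const.add (contDiff_norm_sq ℝ)).sqrt fun w => by positivity).inv
      fun w => (Real.sqrt_pos.2 (by positivity)).ne'
  exact (Complex.ofRealCLM.contDiff (n := ∞)).comp h

lemma contDiff_transversal (i : Fin 2) (Θ u : Circle) :
    ContDiff ℝ ∞ (inclS1xS3 ∘ transversal i Θ u) := by
  refine ContDiff.prodMk (contDiff_const (c := (Θ : ℂ))) ((contDiff_piLp 2).2 fun k => ?_)
  refine contDiff_sqrt_inv.mul ?_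
  change ContDiff ℝ ∞ fun w : ℂ => if k = i then (u : ℂ) else w
  split_ifs
  · exact contDiff_const
  · exact contDiff_id

lemma transversal_snd_eq_zero_iff {i j : Fin 2} (hij : i ≠ j) {Θ u : Circle} {w : ℂ} :
    (transversal i Θ u w).2.1 j = 0 ↔ w = 0 := by
  rw [transversal_snd, if_neg hij.symm, mul_eq_zero, or_iff_right]
  have : 0 < √(1 + ‖w‖ ^ 2) := Real.sqrt_pos.2 (by positivity)
  exact Complex.ofReal_ne_zero.2 (inv_pos.2 this).ne'

lemma S3_normSq_of_ne {i j : Fin 2} (hij : i ≠ j) (x : S1xS3) :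
    ‖x.2.1 i‖ ^ 2 + ‖x.2.1 j‖ ^ 2 = 1 := by
  have := S3_normSq x
  simp only [Complex.normSq_eq_norm_sq] at this
  fin_cases i <;> fin_cases j <;> simp_all
  linarith

/-- On the sphere `1 + |ξ_j / ξ_i|² = |ξ_i|⁻²`, so the normalizing factor of `spherePoint` recovers
`|ξ_i|` from the transverse coordinate. -/
lemma sqrt_inv_eq_norm {i j : Fin 2} (hij : i ≠ j) (x : S1xS3) (hx : x.2.1 i ≠ 0) :
    (√(1 + (‖x.2.1 j‖ / ‖x.2.1 i‖) ^ 2))⁻¹ = ‖x.2.1 i‖ := by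
  have h := S3_normSq_of_ne hij x
  have hi := norm_pos_iff.2 hx
  have : 1 + (‖x.2.1 j‖ / ‖x.2.1 i‖) ^ 2 = (‖x.2.1 i‖⁻¹) ^ 2 := by
    field_simp; exact h
  rw [this, Real.sqrt_sq (by positivity), inv_inv]

lemma exists_eq_transversal {i : Fin 2} (p : S1xS3) (hp : p.2.1 i ≠ 0) :
    ∃ Θ u w, p = transversal i Θ u w := by
  obtain ⟨j, hij⟩ : ∃ j, i ≠ j := fin_two_exists_ne i
  have hi := norm_pos_iff.2 hp
  refine ⟨p.1, Circle.exp (p.2.1 i).arg, p.2.1 j / ‖p.2.1 i‖, S1xS3_ext rfl fun k => ?_⟩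
  rw [transversal_snd]
  have : ‖p.2.1 j / (‖p.2.1 i‖ : ℂ)‖ = ‖p.2.1 j‖ / ‖p.2.1 i‖ := by simp
  rw [this, sqrt_inv_eq_norm hij p hp]
  split_ifs with h
  · rw [h, Circle.coe_exp, Complex.norm_mul_exp_arg_mul_I]
  · obtain rfl : k = j := fin_two_eq_of_ne hij h
    rw [mul_div_cancel₀]
    exact_mod_cast hi.ne'

/-! ### Flow box coordinates -/

section FlowBox

variable (c : Fin 2 → ℂ) (i j : Fin 2) (Θ u : Circle)

/-- The first leaf coordinate, as a function on the ambient space. -/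
def flowBoxS (Y : ℂ × C2) : ℝ := -(Complex.log (Y.1 * (Θ⁻¹ : Circle))).im / (4 * Real.pi)

/-- The coordinate with index `i`, rotated back along the flow of the Lee field. -/
def flowBoxU (Y : ℂ × C2) : ℂ := Y.2 i * ((u⁻¹ : Circle) * phase (c i) (-flowBoxS Θ Y) 0)

/-- The second leaf coordinate. -/
def flowBoxT (Y : ℂ × C2) : ℝ := -(Complex.log (flowBoxU c i Θ u Y)).im / (2 * (c i).re)

/-- The transverse coordinate. -/
def flowBoxW (Y : ℂ × C2) : ℂ :=
  phase (c j) (-flowBoxS Θ Y) (-flowBoxT c i Θ u Y) * (Y.2 j * ((‖Y.2 i‖⁻¹ : ℝ) : ℂ))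

/-- The domain on which the coordinates are smooth. -/
def flowBoxDomain : Set (ℂ × C2) :=
  {Y | Y.1 * (Θ⁻¹ : Circle) ∈ Complex.slitPlane ∧ flowBoxU c i Θ u Y ∈ Complex.slitPlane}

/-- The coordinates of the flow box. -/
def flowBoxCoord (Y : ℂ × C2) : (Fin 2 → ℝ) × ℂ :=
  (![flowBoxS Θ Y, flowBoxT c i Θ u Y], flowBoxW c i j Θ u Y)

variable {c i j Θ u}

lemma contDiffAt_clog_im {F : Type*} [NormedAddCommGroup F] [NormedSpace ℝ F] {f : F → ℂ} {x : F}
    (hf : ContDiffAt ℝ ∞ f x) (h : f x ∈ Complex.slitPlane) :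
    ContDiffAt ℝ ∞ (fun x => (Complex.log (f x)).im) x :=
  (Complex.imCLM.contDiff.contDiffAt (n := ∞)).comp x
    (((Complex.contDiffAt_log h).restrict_scalars ℝ).comp x hf)

lemma contDiffAt_phase {F : Type*} [NormedAddCommGroup F] [NormedSpace ℝ F] (z : ℂ) {s t : F → ℝ}
    {x : F} (hs : ContDiffAt ℝ ∞ s x) (ht : ContDiffAt ℝ ∞ t x) :
    ContDiffAt ℝ ∞ (fun x => (phase z (s x) (t x) : ℂ)) x :=
  ContDiffAt.comp (g := fun y : ℝ × ℝ => (phase z y.1 y.2 : ℂ)) x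
    (contDiff_phase z contDiff_fst contDiff_snd).contDiffAt (hs.prodMk ht)

lemma contDiff_coord (k : Fin 2) : ContDiff ℝ ∞ fun Y : ℂ × C2 => Y.2 k :=
  (contDiff_piLp 2).1 contDiff_snd k

lemma contDiffAt_flowBoxS {Y : ℂ × C2} (h : Y.1 * (Θ⁻¹ : Circle) ∈ Complex.slitPlane) :
    ContDiffAt ℝ ∞ (flowBoxS Θ) Y :=
  (contDiffAt_clog_im (contDiff_fst.mul contDiff_const).contDiffAt h).neg.div_const _

lemma contDiffAt_flowBoxU {Y : ℂ × C2} (h : Y.1 * (Θ⁻¹ : Circle) ∈ Complex.slitPlane) :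
    ContDiffAt ℝ ∞ (flowBoxU c i Θ u) Y :=
  (contDiff_coord i).contDiffAt.mul (contDiffAt_const.mul
    (contDiffAt_phase (c i) (contDiffAt_flowBoxS h).neg contDiffAt_const))

lemma contDiffAt_flowBoxCoord {Y : ℂ × C2} (h : Y ∈ flowBoxDomain c i Θ u) :
    ContDiffAt ℝ ∞ (flowBoxCoord c i j Θ u) Y := by
  have hS := contDiffAt_flowBoxS h.1
  have hT : ContDiffAt ℝ ∞ (flowBoxT c i Θ u) Y :=
    (contDiffAt_clog_im (contDiffAt_flowBoxU h.1) h.2).neg.div_const _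
  -- `flowBoxW` divides by the norm of this coordinate, which is smooth only away from zero.
  have hne : Y.2 i ≠ 0 := fun h0 => Complex.slitPlane_ne_zero h.2 (by simp [flowBoxU, h0])
  refine ContDiffAt.prodMk (contDiffAt_pi.2 fun k => ?_) ?_
  · revert k
    simp only [Fin.forall_fin_two]
    exact ⟨hS, hT⟩
  · refine (contDiffAt_phase (c j) hS.neg hT.neg).mul ((contDiff_coord j).contDiffAt.mul ?_)
    refine (Complex.ofRealCLM.contDiff.contDiffAt (n := ∞)).comp Y ?_
    exact ((contDiff_coord i).contDiffAt.norm ℝ hne).inv (norm_ne_zero_iff.2 hne)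

/-- The second condition involves `flowBoxS`, hence a logarithm, and is known to be open only
relative to the first. -/
lemma isOpen_flowBoxDomain : IsOpen (flowBoxDomain c i Θ u) := by
  have h1 : IsOpen {Y : ℂ × C2 | Y.1 * (Θ⁻¹ : Circle) ∈ Complex.slitPlane} :=
    Complex.isOpen_slitPlane.preimage (by fun_prop)
  have h2 : ContinuousOn (flowBoxU c i Θ u) {Y : ℂ × C2 | Y.1 * (Θ⁻¹ : Circle) ∈ Complex.slitPlane} :=
    fun Y h => (contDiffAt_flowBoxU h).continuousAt.continuousWithinAt
  exact h2.isOpen_inter_preimage h1 Complex.isOpen_slitPlane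

lemma phase_mul_phase_neg (z : ℂ) (s t : ℝ) : (phase z s t : ℂ) * phase z (-s) (-t) = 1 := by
  rw [← Circle.coe_mul, ← phase_add]; simp [phase_zero]

lemma hopfFlow_flowBoxCoord (hc : ∀ k, 0 < (c k).re) (hij : i ≠ j) {x : S1xS3}
    (hx : inclS1xS3 x ∈ flowBoxDomain c i Θ u) :
    hopfFlow c (flowBoxS Θ (inclS1xS3 x)) (flowBoxT c i Θ u (inclS1xS3 x))
      (transversal i Θ u (flowBoxW c i j Θ u (inclS1xS3 x))) = x := by
  set s := flowBoxS Θ (inclS1xS3 x) with hs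
  set t := flowBoxT c i Θ u (inclS1xS3 x) with ht
  have hU : flowBoxU c i Θ u (inclS1xS3 x) = x.2.1 i * ((u⁻¹ : Circle) * phase (c i) (-s) 0) := rfl
  have hne : x.2.1 i ≠ 0 := fun h0 => Complex.slitPlane_ne_zero hx.2 (by rw [hU, h0, zero_mul])
  have hW : flowBoxW c i j Θ u (inclS1xS3 x) =
    phase (c j) (-s) (-t) * (x.2.1 j * ((‖x.2.1 i‖⁻¹ : ℝ) : ℂ)) := rfl
  have hnW : ‖flowBoxW c i j Θ u (inclS1xS3 x)‖ = ‖x.2.1 j‖ / ‖x.2.1 i‖ := by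
    rw [hW]; simp [Circle.norm_coe, div_eq_mul_inv]
  refine S1xS3_ext ?_ fun k => ?_
  · have : Circle.exp (-4 * Real.pi * s) = x.1 * Θ⁻¹ := by
      rw [← Circle.exp_arg (x.1 * Θ⁻¹)]
      congr 1
      rw [hs, flowBoxS, Complex.log_im]
      field_simp
      simp [inclS1xS3]
    rw [hopfFlow_fst, this, transversal, inv_mul_cancel_right]
  · rw [hopfFlow_snd, transversal_snd, hnW, sqrt_inv_eq_norm hij x hne]
    split_ifs with h
    · subst h
      have hnU : ‖flowBoxU c k Θ u (inclS1xS3 x)‖ = ‖x.2.1 k‖ := by rw [hU]; simp [Circle.norm_coe]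
      have e1 : (‖x.2.1 k‖ : ℂ) * phase (c k) 0 t = flowBoxU c k Θ u (inclS1xS3 x) := by
        rw [← hnU]
        conv_rhs => rw [← Complex.norm_mul_exp_arg_mul_I (flowBoxU c k Θ u (inclS1xS3 x))]
        rw [phase, Circle.coe_exp]
        congr 3
        rw [ht, flowBoxT, Complex.log_im]
        have := (hc k).ne'
        field_simp
        simp
      have e2 : (phase (c k) s t : ℂ) = phase (c k) s 0 * phase (c k) 0 t := by
        rw [← Circle.coe_mul, ← phase_add]; simp
      have e3 := phase_mul_phase_neg (c k) s 0
      rw [neg_zero] at e3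
      have e4 : (u : ℂ) * (u⁻¹ : Circle) = 1 := by rw [← Circle.coe_mul]; simp
      rw [hU] at e1
      linear_combination (‖x.2.1 k‖ * u : ℂ) * e2 + (phase (c k) s 0 * u : ℂ) * e1 +
        (x.2.1 k * u * (u⁻¹ : Circle)) * e3 + x.2.1 k * e4
    · obtain rfl : k = j := fin_two_eq_of_ne hij h
      rw [hW]
      have e3 := phase_mul_phase_neg (c k) s t
      have e4 : (‖x.2.1 i‖ : ℂ) * ((‖x.2.1 i‖⁻¹ : ℝ) : ℂ) = 1 := by
        rw [← Complex.ofReal_mul, mul_inv_cancel₀ (norm_ne_zero_iff.2 hne), Complex.ofReal_one]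
      linear_combination (‖x.2.1 i‖ * x.2.1 k * ((‖x.2.1 i‖⁻¹ : ℝ) : ℂ)) * e3 + x.2.1 k * e4

/-- The bounds say that `4πs` and `2t Re c_i` lie strictly between `-π` and `π`, so the principal
logarithms return `s` and `t` themselves and not just their classes modulo a period. -/
lemma flowBoxCoord_hopfFlow (hc : ∀ k, 0 < (c k).re) (hij : i ≠ j) {s t : ℝ} (w : ℂ)
    (hs : |s| < 1 / 4) (ht : |t| < Real.pi / (2 * (c i).re)) :
    inclS1xS3 (hopfFlow c s t (transversal i Θ u w)) ∈ flowBoxDomain c i Θ u ∧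
    flowBoxCoord c i j Θ u (inclS1xS3 (hopfFlow c s t (transversal i Θ u w))) = (![s, t], w) := by
  set x := hopfFlow c s t (transversal i Θ u w) with hx
  have hpi := Real.pi_pos
  have hci := hc i
  have hs' := abs_lt.1 hs
  have ht' := abs_lt.1 ht
  have hslit : ∀ θ : ℝ, -Real.pi < θ → θ < Real.pi → ∀ ρ : ℝ, 0 < ρ →
      (ρ : ℂ) * Circle.exp θ ∈ Complex.slitPlane ∧
        (Complex.log ((ρ : ℂ) * Circle.exp θ)).im = θ := fun θ h1 h2 ρ hρ => by
    have harg : ((ρ : ℂ) * Circle.exp θ).arg = θ := by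
      rw [Complex.arg_real_mul _ hρ, Circle.arg_exp h1 h2.le]
    refine ⟨Complex.mem_slitPlane_iff_arg.2 ⟨by rw [harg]; exact h2.ne, ?_⟩, by
      rw [Complex.log_im, harg]⟩
    exact mul_ne_zero (by exact_mod_cast hρ.ne') (Circle.coe_ne_zero _)
  have h1 : (inclS1xS3 x).1 * (Θ⁻¹ : Circle) = ((1 : ℝ) : ℂ) * Circle.exp (-4 * Real.pi * s) := by
    rw [Complex.ofReal_one, one_mul, ← mul_inv_cancel_right (Circle.exp (-4 * Real.pi * s)) Θ]
    rfl
  obtain ⟨h2, h3⟩ := hslit (-4 * Real.pi * s) (by nlinarith) (by nlinarith) 1 one_pos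
  rw [← h1] at h2 h3
  have hS : flowBoxS Θ (inclS1xS3 x) = s := by
    rw [flowBoxS, h3]; field_simp
  have hρ : 0 < (√(1 + ‖w‖ ^ 2))⁻¹ := inv_pos.2 (Real.sqrt_pos.2 (by positivity))
  set ρ := (√(1 + ‖w‖ ^ 2))⁻¹ with hρdef
  have hi : (inclS1xS3 x).2 i = phase (c i) s t * (ρ * u) := by
    change x.2.1 i = _
    rw [hx, hopfFlow_snd, transversal_snd, if_pos rfl]
  have hj : (inclS1xS3 x).2 j = phase (c j) s t * (ρ * w) := by
    change x.2.1 j = _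
    rw [hx, hopfFlow_snd, transversal_snd, if_neg hij.symm]
  have hU : flowBoxU c i Θ u (inclS1xS3 x) = (ρ : ℂ) * Circle.exp (-2 * t * (c i).re) := by
    have e4 : (u : ℂ) * (u⁻¹ : Circle) = 1 := by rw [← Circle.coe_mul]; simp
    have e5 : (phase (c i) s t : ℂ) * phase (c i) (-s) 0 = Circle.exp (-2 * t * (c i).re) := by
      rw [← Circle.coe_mul, ← phase_add, phase]; ring_nf
    rw [flowBoxU, hS, hi]
    linear_combination (ρ : ℂ) * e5 + (phase (c i) s t * ρ * phase (c i) (-s) 0 : ℂ) * e4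
  have ht2 : -Real.pi < 2 * (c i).re * t ∧ 2 * (c i).re * t < Real.pi := by
    rw [lt_div_iff₀ (by positivity)] at ht'
    have := ht'.1
    rw [← neg_div, div_lt_iff₀ (by positivity)] at this
    constructor <;> linarith
  obtain ⟨h4, h5⟩ := hslit (-2 * t * (c i).re) (by linarith) (by linarith) ρ hρ
  rw [← hU] at h4 h5
  have hT : flowBoxT c i Θ u (inclS1xS3 x) = t := by
    rw [flowBoxT, h5]; field_simp
  refine ⟨⟨h2, h4⟩, Prod.ext ?_ ?_⟩
  · rw [flowBoxCoord, hS, hT]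
  · simp only [flowBoxCoord, flowBoxW, hS, hT, hi, hj]
    have e3 := phase_mul_phase_neg (c j) s t
    have e4 : (ρ : ℂ) * ((ρ⁻¹ : ℝ) : ℂ) = 1 := by
      rw [← Complex.ofReal_mul, mul_inv_cancel₀ hρ.ne', Complex.ofReal_one]
    have e5 : ‖(phase (c i) s t * (ρ * u) : ℂ)‖ = ρ := by simp [Circle.norm_coe, abs_of_pos hρ]
    rw [e5]
    linear_combination (ρ * w * ((ρ⁻¹ : ℝ) : ℂ)) * e3 + w * e4

end FlowBox

/-! ### Flat cubical charts -/

/-- An open disk of the plane is diffeomorphic to an open square. -/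
lemma exists_diskToCube (w₀ : ℂ) {ε r : ℝ} (hε : 0 < ε) (hr : 0 < r) :
    ∃ κ : OpenPartialHomeomorph ℂ (Fin 2 → ℝ), κ.source = Metric.ball w₀ ε ∧
      κ.target = Metric.ball 0 r ∧ κ w₀ = 0 ∧ ContDiffOn ℝ ∞ κ κ.source ∧
      ContDiffOn ℝ ∞ κ.symm κ.target := by
  -- `univBall` maps a whole space onto a round ball. The disk is expanded to the plane, and the
  -- one-dimensional version is then applied in each coordinate, which gives a ball of the sup norm.
  let D := OpenPartialHomeomorph.univBall w₀ ε
  let e : ℂ ≃L[ℝ] (Fin 2 → ℝ) :=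
    Complex.equivRealProdCLM.trans (ContinuousLinearEquiv.finTwoArrow ℝ ℝ).symm
  let J := OpenPartialHomeomorph.univBall (0 : ℝ) r
  let P : OpenPartialHomeomorph (Fin 2 → ℝ) (Fin 2 → ℝ) := OpenPartialHomeomorph.pi fun _ => J
  have hDs : D.source = Set.univ := OpenPartialHomeomorph.univBall_source _ _
  have hDt : D.target = Metric.ball w₀ ε := OpenPartialHomeomorph.univBall_target _ hε
  have hPs : P.source = Set.univ := by
    simp [P, J, OpenPartialHomeomorph.univBall_source]
  have hPt : P.target = Metric.ball 0 r := by
    rw [ball_pi _ hr]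
    simp [P, J, OpenPartialHomeomorph.univBall_target _ hr]
  have hJ : ContDiff ℝ ∞ J := OpenPartialHomeomorph.contDiff_univBall
  have hJ' : ContDiffOn ℝ ∞ J.symm (Metric.ball 0 r) :=
    OpenPartialHomeomorph.contDiffOn_univBall_symm
  have hD : ContDiff ℝ ∞ D := OpenPartialHomeomorph.contDiff_univBall
  have hD' : ContDiffOn ℝ ∞ D.symm (Metric.ball w₀ ε) :=
    OpenPartialHomeomorph.contDiffOn_univBall_symm
  have hP : ContDiff ℝ ∞ P := contDiff_pi.2 fun k => hJ.comp (contDiff_apply ℝ ℝ k)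
  have hP' : ContDiffOn ℝ ∞ P.symm (Metric.ball 0 r) := by
    refine contDiffOn_pi.2 fun k => hJ'.comp (contDiff_apply ℝ ℝ k).contDiffOn fun y hy => ?_
    rw [ball_pi _ hr] at hy
    exact hy k trivial
  refine ⟨(D.symm.trans e.toHomeomorph.toOpenPartialHomeomorph).trans P, ?_, ?_, ?_, ?_, ?_⟩
  · simp [hDt, hPs]
  · simp [hDs, hPt]
  · have h1 : D.symm w₀ = 0 := OpenPartialHomeomorph.univBall_symm_apply_center _ _
    have h2 : J 0 = 0 := OpenPartialHomeomorph.univBall_apply_zero _ _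
    simp only [OpenPartialHomeomorph.coe_trans, Function.comp, h1]
    have h3 : e.toHomeomorph.toOpenPartialHomeomorph 0 = 0 := e.map_zero
    rw [h3]
    ext k
    exact h2
  · have : ((D.symm.trans e.toHomeomorph.toOpenPartialHomeomorph).trans P).source =
      Metric.ball w₀ ε := by simp [hDt, hPs]
    rw [this]
    exact (hP.comp e.contDiff).comp_contDiffOn hD'
  · have : ((D.symm.trans e.toHomeomorph.toOpenPartialHomeomorph).trans P).target =
      Metric.ball 0 r := by simp [hDs, hPt]
    rw [this]
    exact (hD.comp e.symm.contDiff).comp_contDiffOn hP'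

section FlowBox

variable {c : Fin 2 → ℂ} {i j : Fin 2}

/-- The inverse of the flow box coordinates. -/
def flowBoxParam (c : Fin 2 → ℂ) (i : Fin 2) (Θ u : Circle) (y : (Fin 2 → ℝ) × ℂ) : S1xS3 :=
  hopfFlow c (y.1 0) (y.1 1) (transversal i Θ u y.2)

lemma contDiff_flowBoxParam (c : Fin 2 → ℂ) (i : Fin 2) (Θ u : Circle) :
    ContDiff ℝ ∞ (inclS1xS3 ∘ flowBoxParam c i Θ u) :=
  contDiff_hopfFlow c ((contDiff_apply ℝ ℝ 0).comp contDiff_fst)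
    ((contDiff_apply ℝ ℝ 1).comp contDiff_fst) ((contDiff_transversal i Θ u).comp contDiff_snd)

lemma continuous_inclS1xS3 : Continuous inclS1xS3 := contMDiff_inclS1xS3.continuous

/-- The flow box of size `r` around a transversal. -/
def flowBox (hc : ∀ k, 0 < (c k).re) (hij : i ≠ j) (Θ u : Circle) {r : ℝ} (hr : 0 < r)
    (hr1 : r ≤ 1 / 4) (hr2 : r ≤ Real.pi / (2 * (c i).re)) :
    OpenPartialHomeomorph S1xS3 ((Fin 2 → ℝ) × ℂ) where
  toFun x := flowBoxCoord c i j Θ u (inclS1xS3 x)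
  invFun := flowBoxParam c i Θ u
  source := inclS1xS3 ⁻¹' (flowBoxDomain c i Θ u ∩
    flowBoxCoord c i j Θ u ⁻¹' (Metric.ball 0 r ×ˢ Set.univ))
  target := Metric.ball 0 r ×ˢ Set.univ
  map_source' x hx := hx.2
  map_target' y hy := by
    have h1 := hy.1
    rw [ball_pi _ hr, Set.mem_univ_pi] at h1
    have h2 := h1 0
    have h3 := h1 1
    rw [Pi.zero_apply, mem_ball_zero_iff, Real.norm_eq_abs] at h2 h3
    obtain ⟨h4, h5⟩ := flowBoxCoord_hopfFlow (Θ := Θ) (u := u) hc hij y.2 (h2.trans_le hr1)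
      (h3.trans_le hr2)
    refine ⟨h4, ?_⟩
    rw [Set.mem_preimage, flowBoxParam, h5]
    refine ⟨?_, trivial⟩
    convert hy.1 using 1
    ext k
    revert k; simp [Fin.forall_fin_two]
  left_inv' x hx := hopfFlow_flowBoxCoord hc hij hx.1
  right_inv' y hy := by
    have h1 := hy.1
    rw [ball_pi _ hr, Set.mem_univ_pi] at h1
    have h2 := h1 0
    have h3 := h1 1
    rw [Pi.zero_apply, mem_ball_zero_iff, Real.norm_eq_abs] at h2 h3
    obtain ⟨h4, h5⟩ := flowBoxCoord_hopfFlow (Θ := Θ) (u := u) hc hij y.2 (h2.trans_le hr1)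
      (h3.trans_le hr2)
    refine h5.trans (Prod.ext ?_ rfl)
    ext k
    revert k; simp [Fin.forall_fin_two]
  open_source := by
    refine IsOpen.preimage continuous_inclS1xS3 ?_
    refine ContinuousOn.isOpen_inter_preimage
      (fun Y hY => (contDiffAt_flowBoxCoord hY).continuousAt.continuousWithinAt)
      isOpen_flowBoxDomain (Metric.isOpen_ball.prod isOpen_univ)
  open_target := Metric.isOpen_ball.prod isOpen_univ
  continuousOn_toFun x hx := ((contDiffAt_flowBoxCoord hx.1).continuousAt.comp
    continuous_inclS1xS3.continuousAt).continuousWithinAt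
  continuousOn_invFun :=
    (contMDiff_of_inclS1xS3 (contDiff_flowBoxParam c i Θ u)).continuous.continuousOn

/-- A chart whose inverse follows the flow in the first factor is flat. -/
lemma flat_of_hopfFlow {φ : OpenPartialHomeomorph S1xS3 ((Fin 2 → ℝ) × (Fin 2 → ℝ))}
    (hφ : φ.MDifferentiable modelS1xS3 𝓘(ℝ, (Fin 2 → ℝ) × (Fin 2 → ℝ)))
    {Φ : ℂ × C2 → (Fin 2 → ℝ) × (Fin 2 → ℝ)} (hΦ : ⇑φ = Φ ∘ inclS1xS3)
    (hΦd : ∀ x ∈ φ.source, DifferentiableAt ℝ Φ (inclS1xS3 x))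
    {σ : (Fin 2 → ℝ) → S1xS3} (hσ : ∀ y, φ.symm y = hopfFlow c (y.1 0) (y.1 1) (σ y.2))
    {x : S1xS3} (hx : x ∈ φ.source) (v : TangentSpace modelS1xS3 x) :
    v ∈ canonicalDistribution (c 0) (c 1) x ↔
      mfderiv modelS1xS3 𝓘(ℝ, Fin 2 → ℝ) (fun y => (φ y).2) x v = (0 : Fin 2 → ℝ) := by
  set I' := 𝓘(ℝ, (Fin 2 → ℝ) × (Fin 2 → ℝ))
  have hy : φ x ∈ φ.target := φ.map_source hx
  have hsymm : MDifferentiableAt I' modelS1xS3 φ.symm (φ x) := hφ.mdifferentiableAt_symm hy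
  have hxx : φ.symm (φ x) = x := φ.left_inv hx
  have hinc : DifferentiableAt ℝ (inclS1xS3 ∘ φ.symm) (φ x) :=
    ((mdifferentiableAt_inclS1xS3 _).comp (φ x) hsymm).differentiableAt
  -- Moving in the first factor of the chart is moving along the flow, so the inverse chart sends
  -- `(h, 0)` to a combination of `B` and `JB`.
  have hline : ∀ h : Fin 2 → ℝ, fderiv ℝ (inclS1xS3 ∘ φ.symm) (φ x) (h, 0) =
      h 0 • leeField (c 0) (c 1) x + h 1 • antiLeeField (c 0) (c 1) x := fun h => by
    have h1 : HasDerivAt (fun τ : ℝ => φ x + τ • ((h, 0) : (Fin 2 → ℝ) × (Fin 2 → ℝ))) (h, 0) 0 := by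
      simpa using ((hasDerivAt_id (0 : ℝ)).smul_const
        ((h, 0) : (Fin 2 → ℝ) × (Fin 2 → ℝ))).const_add (φ x)
    have h0 : φ x = φ x + (0 : ℝ) • ((h, 0) : (Fin 2 → ℝ) × (Fin 2 → ℝ)) := by simp
    have h2 := (h0 ▸ hinc.hasFDerivAt :
      HasFDerivAt _ _ (φ x + (0 : ℝ) • ((h, 0) : (Fin 2 → ℝ) × (Fin 2 → ℝ)))).comp_hasDerivAt 0 h1
    have h3 : ∀ k, HasDerivAt (fun τ : ℝ => (φ x).1 k + τ * h k) (h k) 0 := fun k => by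
      simpa using ((hasDerivAt_id (0 : ℝ)).mul_const (h k)).const_add ((φ x).1 k)
    have h4 := hasDerivAt_hopfFlow c (σ (φ x).2) (h3 0) (h3 1)
    have h5 : (fun τ : ℝ => inclS1xS3 (hopfFlow c ((φ x).1 0 + τ * h 0) ((φ x).1 1 + τ * h 1)
        (σ (φ x).2))) = (inclS1xS3 ∘ φ.symm) ∘
          fun τ : ℝ => φ x + τ • ((h, 0) : (Fin 2 → ℝ) × (Fin 2 → ℝ)) := by
      ext1 τ
      simp [hσ]
    rw [h5] at h4
    have h6 := h2.unique h4
    rw [← h0, zero_mul, zero_mul, add_zero, add_zero, ← hσ, hxx] at h6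
    exact h6
  have hsnd : ∀ v : TangentSpace modelS1xS3 x,
      mfderiv modelS1xS3 𝓘(ℝ, Fin 2 → ℝ) (fun y => (φ y).2) x v =
        ((mfderiv modelS1xS3 I' φ x v : (Fin 2 → ℝ) × (Fin 2 → ℝ))).2 := fun v => by
    have h1 : MDifferentiableAt I' 𝓘(ℝ, Fin 2 → ℝ)
        (Prod.snd : (Fin 2 → ℝ) × (Fin 2 → ℝ) → _) (φ x) :=
      differentiableAt_snd.mdifferentiableAt
    have h2 := mfderiv_comp_apply x h1 (hφ.mdifferentiableAt hx) v
    rw [mfderiv_eq_fderiv, fderiv_snd] at h2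
    exact h2
  have hΦv : ∀ v : TangentSpace modelS1xS3 x, mfderiv modelS1xS3 I' φ x v =
      fderiv ℝ Φ (inclS1xS3 x) (mfderiv modelS1xS3 𝓘(ℝ, ℂ × C2) inclS1xS3 x v) := fun v => by
    have h2 := mfderiv_comp_apply x (hΦd x hx).mdifferentiableAt
      (mdifferentiableAt_inclS1xS3 x) v
    rw [← hΦ, mfderiv_eq_fderiv] at h2
    exact h2
  have hcomp : ∀ v : TangentSpace modelS1xS3 x,
      mfderiv modelS1xS3 𝓘(ℝ, ℂ × C2) inclS1xS3 x v =
        fderiv ℝ (inclS1xS3 ∘ φ.symm) (φ x) (mfderiv modelS1xS3 I' φ x v) := fun v => by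
    have h1 := mfderiv_comp_apply x hinc.mdifferentiableAt (hφ.mdifferentiableAt hx) v
    rw [mfderiv_eq_fderiv] at h1
    refine Eq.trans ?_ h1
    have h2 : (inclS1xS3 ∘ φ.symm) ∘ φ =ᶠ[nhds x] inclS1xS3 := by
      filter_upwards [φ.open_source.mem_nhds hx] with z hz
      simp [φ.left_inv hz]
    exact (DFunLike.congr_fun h2.mfderiv_eq v).symm
  -- The ambient extension `Φ` of the chart inverts the ambient parametrization. Together with
  -- `hcomp`, this relates the chart image and the ambient image of `v` in both directions.
  have hcomp' : ∀ w : (Fin 2 → ℝ) × (Fin 2 → ℝ),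
      fderiv ℝ Φ (inclS1xS3 x) (fderiv ℝ (inclS1xS3 ∘ φ.symm) (φ x) w) = w := fun w => by
    have h1 : HasFDerivAt Φ (fderiv ℝ Φ (inclS1xS3 x)) ((inclS1xS3 ∘ φ.symm) (φ x)) := by
      rw [Function.comp_apply, hxx]; exact (hΦd x hx).hasFDerivAt
    have h2 : Φ ∘ (inclS1xS3 ∘ φ.symm) =ᶠ[nhds (φ x)] id := by
      filter_upwards [φ.open_target.mem_nhds hy] with z hz
      rw [← Function.comp_assoc, ← hΦ, Function.comp_apply, φ.right_inv hz, id]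
    have h3 := (h1.comp _ hinc.hasFDerivAt).congr_of_eventuallyEq h2.symm
    exact DFunLike.congr_fun (h3.unique (hasFDerivAt_id _)) w
  rw [hsnd, mem_canonicalDistribution]
  constructor
  · rintro ⟨s, t, h⟩
    have := hline ![s, t]
    simp only [Matrix.cons_val_zero, Matrix.cons_val_one] at this
    rw [hΦv, ← h, ← this, hcomp']
  · intro h
    refine ⟨(mfderiv modelS1xS3 I' φ x v : (Fin 2 → ℝ) × (Fin 2 → ℝ)).1 0,
      (mfderiv modelS1xS3 I' φ x v : (Fin 2 → ℝ) × (Fin 2 → ℝ)).1 1, ?_⟩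
    rw [← hline, hcomp]
    congr 1
    exact Prod.ext rfl h.symm

/-- Every point `flowBoxParam c i Θ u (0, w₀)` has a flat cubical neighbourhood whose slices are
parametrized by a disk around `w₀` in the transversal. -/
lemma exists_isFlatCubicalChart (hc : ∀ k, 0 < (c k).re) (hij : i ≠ j) (Θ u : Circle) (w₀ : ℂ)
    {ε : ℝ} (hε : 0 < ε) :
    ∃ (φ : OpenPartialHomeomorph S1xS3 ((Fin 2 → ℝ) × (Fin 2 → ℝ))) (κ : ℂ → Fin 2 → ℝ),
      IsFlatCubicalChart modelS1xS3 2 2 (canonicalDistribution (c 0) (c 1))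
        (transversal i Θ u w₀) φ ∧
      Set.InjOn κ (Metric.ball w₀ ε) ∧
      (∀ x ∈ φ.source, ∃ s t : ℝ, ∃ w ∈ Metric.ball w₀ ε,
        x = hopfFlow c s t (transversal i Θ u w) ∧ (φ x).2 = κ w) ∧
      ∀ w ∈ Metric.ball w₀ ε, transversal i Θ u w ∈ φ.source ∧
        (φ (transversal i Θ u w)).2 = κ w := by
  obtain ⟨r, hr, hr1, hr2⟩ : ∃ r : ℝ, 0 < r ∧ r ≤ 1 / 4 ∧ r ≤ Real.pi / (2 * (c i).re) :=
    ⟨min (1 / 4) (Real.pi / (2 * (c i).re)),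
      lt_min (by norm_num) (div_pos Real.pi_pos (mul_pos two_pos (hc i))),
      min_le_left _ _, min_le_right _ _⟩
  -- The transverse square gets the radius `r` of the leaf directions, so that the product is a
  -- cube.
  obtain ⟨κ, hκs, hκt, hκ0, hκ, hκ'⟩ := exists_diskToCube w₀ hε hr
  let Ψ := flowBox hc hij Θ u hr hr1 hr2
  let φ := Ψ.trans ((OpenPartialHomeomorph.refl (Fin 2 → ℝ)).prod κ)
  let Φ : ℂ × C2 → (Fin 2 → ℝ) × (Fin 2 → ℝ) := fun Y =>
    ((flowBoxCoord c i j Θ u Y).1, κ (flowBoxCoord c i j Θ u Y).2)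
  have hΦ : ⇑φ = Φ ∘ inclS1xS3 := rfl
  have hsymm : ⇑φ.symm = flowBoxParam c i Θ u ∘ Prod.map id κ.symm := rfl
  have htarget : φ.target = Metric.ball 0 r := by
    ext y
    rw [← Prod.mk_zero_zero, ← ball_prod_same]
    simp [φ, Ψ, flowBox, hκt, and_comm]
  have hsource : ∀ x ∈ φ.source, inclS1xS3 x ∈ flowBoxDomain c i Θ u ∧
      flowBoxW c i j Θ u (inclS1xS3 x) ∈ Metric.ball w₀ ε := fun x hx => by
    have h1 : x ∈ Ψ.source := hx.1
    have h2 : flowBoxW c i j Θ u (inclS1xS3 x) ∈ κ.source := hx.2.2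
    exact ⟨h1.1, hκs ▸ h2⟩
  have hΦd : ∀ x ∈ φ.source, ContDiffAt ℝ ∞ Φ (inclS1xS3 x) := fun x hx => by
    obtain ⟨h1, h2⟩ := hsource x hx
    have h3 := contDiffAt_flowBoxCoord (j := j) h1
    have h4 : ContDiffAt ℝ ∞ κ (flowBoxW c i j Θ u (inclS1xS3 x)) :=
      hκ.contDiffAt (κ.open_source.mem_nhds (hκs ▸ h2))
    exact h3.fst.prodMk (h4.comp _ h3.snd)
  have hs : ContMDiffOn modelS1xS3 𝓘(ℝ, (Fin 2 → ℝ) × (Fin 2 → ℝ)) ∞ φ φ.source := fun x hx =>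
    ((hΦd x hx).contMDiffAt.comp x contMDiff_inclS1xS3.contMDiffAt).contMDiffWithinAt
  have hs' : ContMDiffOn 𝓘(ℝ, (Fin 2 → ℝ) × (Fin 2 → ℝ)) modelS1xS3 ∞ φ.symm φ.target := by
    have h1 : ContDiffOn ℝ ∞ (Prod.map (id : (Fin 2 → ℝ) → _) κ.symm) φ.target := by
      refine contDiff_fst.contDiffOn.prodMk (hκ'.comp contDiff_snd.contDiffOn fun y hy => ?_)
      rw [htarget, ← Prod.mk_zero_zero, ← ball_prod_same] at hy
      exact hκt ▸ hy.2
    exact (contMDiff_of_inclS1xS3 (contDiff_flowBoxParam c i Θ u)).comp_contMDiffOn h1.contMDiffOn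
  have htrans : ∀ w ∈ Metric.ball w₀ ε, transversal i Θ u w ∈ φ.source ∧
      φ (transversal i Θ u w) = (0, κ w) := fun w hw => by
    have h1 : κ w ∈ Metric.ball 0 r := hκt ▸ κ.map_source (hκs ▸ hw)
    have h2 : ((0, κ w) : (Fin 2 → ℝ) × (Fin 2 → ℝ)) ∈ φ.target := by
      rw [htarget, ← Prod.mk_zero_zero, ← ball_prod_same]
      exact ⟨Metric.mem_ball_self hr, h1⟩
    have h3 : φ.symm (0, κ w) = transversal i Θ u w := by
      rw [hsymm, Function.comp_apply, Prod.map_apply, κ.left_inv (hκs ▸ hw)]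
      exact hopfFlow_zero c _
    rw [← h3]
    exact ⟨φ.map_target h2, φ.right_inv h2⟩
  have hw₀ := htrans w₀ (Metric.mem_ball_self hε)
  refine ⟨φ, κ, ⟨hs, hs', hw₀.1, by rw [hw₀.2, hκ0]; rfl, ⟨r, hr, htarget⟩, ?_⟩,
    hκs ▸ κ.injOn, fun x hx => ⟨_, _, _, (hsource x hx).2,
      (hopfFlow_flowBoxCoord hc hij (hsource x hx).1).symm, rfl⟩, fun w hw =>
      ⟨(htrans w hw).1, by rw [(htrans w hw).2]⟩⟩
  intro x hx v
  refine flat_of_hopfFlow (σ := fun y => transversal i Θ u (κ.symm y))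
    ⟨hs.mdifferentiableOn (by simp), hs'.mdifferentiableOn (by simp)⟩ hΦ
    (fun x hx => (hΦd x hx).differentiableAt (by simp)) (fun y => rfl) hx v

end FlowBox

/-! ### Holonomy and slice counts -/

/-- The holonomy group of the leaf on which the coordinate with weight `w` vanishes; `z` is the
weight of the other coordinate. -/
def holonomy (z w : ℂ) : Set Circle :=
  {ζ | ∃ s t : ℝ, Circle.exp (-4 * Real.pi * s) = 1 ∧ phase z s t = 1 ∧ phase w s t = ζ}

section Slices

variable {c : Fin 2 → ℂ} {i j : Fin 2} {Θ u : Circle}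

/-- The flow preserves `|ξ_i|`, which is the normalizing factor on the transversal. The two factors
therefore agree and cancel, leaving conditions on the phases alone. -/
lemma hopfFlow_transversal_eq_iff (hij : i ≠ j) {s t : ℝ} {w w' : ℂ} :
    hopfFlow c s t (transversal i Θ u w) = transversal i Θ u w' ↔
      Circle.exp (-4 * Real.pi * s) = 1 ∧ phase (c i) s t = 1 ∧ (phase (c j) s t : ℂ) * w = w' := by
  have hpos : ∀ w : ℂ, 0 < (√(1 + ‖w‖ ^ 2))⁻¹ := fun w =>
    inv_pos.2 (Real.sqrt_pos.2 (by positivity))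
  constructor
  · intro h
    have h0 : Circle.exp (-4 * Real.pi * s) * Θ = Θ := congrArg Prod.fst h
    have hk : ∀ k, (phase (c k) s t : ℂ) * (transversal i Θ u w).2.1 k =
        (transversal i Θ u w').2.1 k := fun k => congrArg (fun x : S1xS3 => x.2.1 k) h
    have hi := hk i
    have hj := hk j
    rw [transversal_snd, transversal_snd, if_pos rfl, if_pos rfl] at hi
    rw [transversal_snd, transversal_snd, if_neg hij.symm, if_neg hij.symm] at hj
    have hn := congrArg norm hi
    simp only [norm_mul, Circle.norm_coe, Complex.norm_real, one_mul, mul_one, Real.norm_eq_abs,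
      abs_of_pos (hpos _)] at hn
    have hne : (((√(1 + ‖w'‖ ^ 2))⁻¹ : ℝ) : ℂ) ≠ 0 := Complex.ofReal_ne_zero.2 (hpos _).ne'
    rw [hn] at hi hj
    refine ⟨by simpa using h0, Circle.ext ?_, ?_⟩
    · have h2 := mul_ne_zero hne (Circle.coe_ne_zero u)
      exact mul_right_cancel₀ h2 (by rw [hi, Circle.coe_one, one_mul])
    · exact mul_left_cancel₀ hne (by rw [← hj]; ring)
  · rintro ⟨h0, hi, rfl⟩
    refine S1xS3_ext ?_ fun k => ?_
    · rw [hopfFlow_fst, h0, one_mul]; rfl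
    · have hn : ‖(phase (c j) s t : ℂ) * w‖ = ‖w‖ := by
        rw [norm_mul, Circle.norm_coe, one_mul]
      rw [hopfFlow_snd, transversal_snd, transversal_snd, hn]
      split_ifs with h
      · rw [h, hi, Circle.coe_one, one_mul]
      · rw [fin_two_eq_of_ne hij h]; ring

lemma transversal_mem_foliationLeaf_iff (hc : ∀ k, 0 < (c k).re) (hij : i ≠ j) {w w' : ℂ} :
    transversal i Θ u w' ∈
        foliationLeaf modelS1xS3 (canonicalDistribution (c 0) (c 1)) (transversal i Θ u w) ↔
      ∃ ζ ∈ holonomy (c i) (c j), w' = ζ * w := by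
  rw [mem_foliationLeaf_iff hc]
  constructor
  · rintro ⟨s, t, h⟩
    obtain ⟨h0, h1, h2⟩ := (hopfFlow_transversal_eq_iff hij).1 h.symm
    exact ⟨_, ⟨s, t, h0, h1, rfl⟩, h2.symm⟩
  · rintro ⟨_, ⟨s, t, h0, h1, rfl⟩, h2⟩
    exact ⟨s, t, ((hopfFlow_transversal_eq_iff hij).2 ⟨h0, h1, h2.symm⟩).symm⟩

/-- The slices that a leaf meets in a flow box correspond to the points of a holonomy orbit. -/
lemma sliceCount_eq_encard (hc : ∀ k, 0 < (c k).re) (hij : i ≠ j) {w₀ w : ℂ} {ε : ℝ}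
    {φ : OpenPartialHomeomorph S1xS3 ((Fin 2 → ℝ) × (Fin 2 → ℝ))} {κ : ℂ → Fin 2 → ℝ}
    (hκ : Set.InjOn κ (Metric.ball w₀ ε))
    (h1 : ∀ x ∈ φ.source, ∃ s t : ℝ, ∃ w ∈ Metric.ball w₀ ε,
        x = hopfFlow c s t (transversal i Θ u w) ∧ (φ x).2 = κ w)
    (h2 : ∀ w ∈ Metric.ball w₀ ε, transversal i Θ u w ∈ φ.source ∧
        (φ (transversal i Θ u w)).2 = κ w) :
    sliceCount φ
        (foliationLeaf modelS1xS3 (canonicalDistribution (c 0) (c 1)) (transversal i Θ u w)) =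
      {w' | w' ∈ Metric.ball w₀ ε ∧ ∃ ζ ∈ holonomy (c i) (c j), w' = ζ * w}.encard := by
  rw [← (hκ.mono fun w hw => hw.1 : Set.InjOn κ
    {w' | w' ∈ Metric.ball w₀ ε ∧ ∃ ζ ∈ holonomy (c i) (c j), w' = ζ * w}).encard_image, sliceCount]
  congr 1
  ext y
  constructor
  · rintro ⟨x, ⟨hx, hxs⟩, rfl⟩
    obtain ⟨s, t, w', hw', rfl, he⟩ := h1 x hxs
    refine ⟨w', ⟨hw', ?_⟩, he.symm⟩
    rw [← transversal_mem_foliationLeaf_iff hc hij,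
      ← foliationLeaf_eq_of_mem hc hx, mem_foliationLeaf_iff hc]
    exact ⟨-s, -t, by rw [← hopfFlow_add]; simp [hopfFlow_zero]⟩
  · rintro ⟨w', ⟨hw', hζ⟩, rfl⟩
    exact ⟨_, ⟨(transversal_mem_foliationLeaf_iff hc hij).2 hζ, (h2 w' hw').1⟩, (h2 w' hw').2⟩

lemma one_mem_holonomy (z w : ℂ) : (1 : Circle) ∈ holonomy z w :=
  ⟨0, 0, by simp, phase_zero _, phase_zero _⟩

/-- Closure under powers is what makes every element of a finite holonomy group a root of unity. -/
lemma pow_mem_holonomy {z w : ℂ} {ζ : Circle} (h : ζ ∈ holonomy z w) (n : ℕ) :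
    ζ ^ n ∈ holonomy z w := by
  obtain ⟨s, t, h0, h1, rfl⟩ := h
  induction n with
  | zero => simpa using one_mem_holonomy z w
  | succ n ih =>
    obtain ⟨s', t', h0', h1', h'⟩ := ih
    refine ⟨s' + s, t' + t, ?_, ?_, ?_⟩
    · rw [mul_add, Circle.exp_add, h0, h0', one_mul]
    · rw [phase_add, h1, h1', one_mul]
    · rw [phase_add, h', pow_succ]

/-- Around a point with vanishing coordinate, the generic leaves meet as many slices as the holonomy
group has elements. -/
lemma hasUniformChart_transversal_zero (hc : ∀ k, 0 < (c k).re) (hij : i ≠ j) {m : ℕ}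
    (hm : (holonomy (c i) (c j)).encard = m) :
    HasUniformChart modelS1xS3 2 2 (canonicalDistribution (c 0) (c 1)) (transversal i Θ u 0) m := by
  obtain ⟨φ, κ, hφ, hκ, h1, h2⟩ := exists_isFlatCubicalChart hc hij Θ u 0 one_pos
  refine ⟨φ, hφ, ?_, fun q hq hqp => ?_⟩
  · rw [sliceCount_eq_encard hc hij hκ h1 h2]
    convert Set.encard_singleton (0 : ℂ)
    ext w
    simp only [mul_zero, Set.mem_ofPred_eq, Set.mem_singleton_iff]
    constructor
    · rintro ⟨-, ζ, -, h⟩; exact h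
    · rintro rfl; exact ⟨Metric.mem_ball_self one_pos, 1, one_mem_holonomy _ _, rfl⟩
  · obtain ⟨s, t, w, hw, rfl, -⟩ := h1 q hq
    rw [foliationLeaf_eq_of_mem hc (hopfFlow_mem_foliationLeaf c s t _),
      sliceCount_eq_encard hc hij hκ h1 h2, ← hm]
    have hw0 : w ≠ 0 := by
      rintro rfl
      exact hqp (hopfFlow_mem_foliationLeaf c s t _)
    have hinj : Function.Injective fun ζ : Circle => (ζ : ℂ) * w := fun ζ ζ' h =>
      Circle.ext (mul_right_cancel₀ hw0 h)
    rw [← hinj.encard_image]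
    congr 1
    ext w'
    constructor
    · rintro ⟨-, ζ, hζ, rfl⟩; exact ⟨ζ, hζ, rfl⟩
    · rintro ⟨ζ, hζ, rfl⟩
      -- The disk is centred at 0, so it contains the whole orbit of each of its points.
      refine ⟨?_, ζ, hζ, rfl⟩
      rw [mem_ball_zero_iff] at hw ⊢
      rwa [norm_mul, Circle.norm_coe, one_mul]

/-- If the holonomy is finite, a point with nonvanishing coordinates has a flow box that every leaf
meets in at most one slice. -/
lemma hasUniformChart_transversal_of_ne (hc : ∀ k, 0 < (c k).re) (hij : i ≠ j) {w₀ : ℂ}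
    (hw₀ : w₀ ≠ 0) (hH : (holonomy (c i) (c j)).Finite) :
    HasUniformChart modelS1xS3 2 2 (canonicalDistribution (c 0) (c 1)) (transversal i Θ u w₀) 1 := by
  obtain ⟨ε, hε, hsep⟩ : ∃ ε > 0, ∀ w ∈ Metric.ball w₀ ε, ∀ ζ ∈ holonomy (c i) (c j),
      (ζ : ℂ) * w ∈ Metric.ball w₀ ε → ζ = 1 := by
    -- Each rotation `ζ ≠ 1` moves `w₀`, hence separates a neighbourhood of `w₀` from its image;
    -- finiteness of the holonomy gives one radius for all of them.
    have h1 : ∀ᶠ y : ℂ × ℂ in nhds (w₀, w₀), ∀ ζ ∈ holonomy (c i) (c j), ζ ≠ 1 →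
        (ζ : ℂ) * y.1 ≠ y.2 := by
      rw [Filter.eventually_all_finite hH]
      intro ζ _
      by_cases hζ : ζ = 1
      · simp [hζ]
      have h2 : ∀ᶠ y : ℂ × ℂ in nhds (w₀, w₀), (ζ : ℂ) * y.1 ≠ y.2 := by
        have h3 : Continuous fun y : ℂ × ℂ => (ζ : ℂ) * y.1 := by fun_prop
        refine (isOpen_ne_fun h3 continuous_snd).mem_nhds fun h => hζ (Circle.ext ?_)
        exact mul_right_cancel₀ hw₀ (by simpa using h)
      filter_upwards [h2] with y hy _ using hy
    obtain ⟨ε, hε, h2⟩ := Metric.eventually_nhds_iff_ball.1 h1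
    refine ⟨ε, hε, fun w hw ζ hζ hζw => ?_⟩
    by_contra hne
    have hmem : (w, (ζ : ℂ) * w) ∈ Metric.ball (w₀, w₀) ε := by
      rw [← ball_prod_same]; exact ⟨hw, hζw⟩
    exact h2 _ hmem ζ hζ hne rfl
  obtain ⟨φ, κ, hφ, hκ, h1, h2⟩ := exists_isFlatCubicalChart hc hij Θ u w₀ hε
  have hone : ∀ w ∈ Metric.ball w₀ ε, sliceCount φ (foliationLeaf modelS1xS3
      (canonicalDistribution (c 0) (c 1)) (transversal i Θ u w)) = 1 := fun w hw => by
    rw [sliceCount_eq_encard hc hij hκ h1 h2]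
    convert Set.encard_singleton w
    ext w'
    constructor
    · rintro ⟨hw', ζ, hζ, rfl⟩
      simp [hsep w hw ζ hζ hw']
    · rintro rfl; exact ⟨hw, 1, one_mem_holonomy _ _, by simp⟩
  refine ⟨φ, hφ, hone w₀ (Metric.mem_ball_self hε), fun q hq _ => ?_⟩
  obtain ⟨s, t, w, hw, rfl, -⟩ := h1 q hq
  rw [foliationLeaf_eq_of_mem hc (hopfFlow_mem_foliationLeaf c s t _), hone w hw, Nat.cast_one]

/-- Leaves that miss the chart count 0 and the leaf through `p` counts 1, whence the need for `1 ≤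
N`. -/
lemma mem_sliceBounds_of_hasUniformChart (hc : ∀ k, 0 < (c k).re) {p : S1xS3} {N : ℕ} (hN : 1 ≤ N)
    (h : HasUniformChart modelS1xS3 2 2 (canonicalDistribution (c 0) (c 1)) p N) :
    N ∈ sliceBounds modelS1xS3 2 2 (canonicalDistribution (c 0) (c 1)) p := by
  obtain ⟨φ, hφ, h1, h2⟩ := h
  refine ⟨φ, hφ, fun q => ?_⟩
  by_cases hq : (foliationLeaf modelS1xS3 (canonicalDistribution (c 0) (c 1)) q ∩ φ.source).Nonempty
  · obtain ⟨x, hx, hxs⟩ := hq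
    rw [← foliationLeaf_eq_of_mem hc hx]
    by_cases hp : x ∈ foliationLeaf modelS1xS3 (canonicalDistribution (c 0) (c 1)) p
    · rw [foliationLeaf_eq_of_mem hc hp, h1]
      exact_mod_cast hN
    · exact (h2 x hxs hp).le
  · rw [sliceCount, Set.not_nonempty_iff_eq_empty.1 hq]
    simp

lemma one_le_of_mem_sliceBounds {p : S1xS3} {N : ℕ}
    (h : N ∈ sliceBounds modelS1xS3 2 2 (canonicalDistribution (c 0) (c 1)) p) : 1 ≤ N := by
  obtain ⟨φ, hφ, h1⟩ := h
  have : 1 ≤ sliceCount φ (foliationLeaf modelS1xS3 (canonicalDistribution (c 0) (c 1)) p) := by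
    rw [sliceCount, Set.one_le_encard_iff_nonempty]
    exact ⟨_, p, ⟨mem_foliationLeaf_self c p, hφ.mem_source⟩, rfl⟩
  exact_mod_cast this.trans (h1 p)

/-- In every flat chart around a point with vanishing coordinate, nearby leaves meet at least as many
slices as the holonomy group has elements. -/
lemma encard_holonomy_le (hc : ∀ k, 0 < (c k).re) (hij : i ≠ j) {N : ℕ}
    (h : N ∈ sliceBounds modelS1xS3 2 2 (canonicalDistribution (c 0) (c 1)) (transversal i Θ u 0)) :
    (holonomy (c i) (c j)).encard ≤ N := by
  obtain ⟨φ, hφ, hN⟩ := h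
  set p := transversal i Θ u 0
  have hσ : ContMDiff 𝓘(ℝ, ℂ) modelS1xS3 ∞ (transversal i Θ u) :=
    contMDiff_of_inclS1xS3 (contDiff_transversal i Θ u)
  have hφp : ContMDiffAt modelS1xS3 𝓘(ℝ, (Fin 2 → ℝ) × (Fin 2 → ℝ)) ∞ φ p :=
    hφ.smooth.contMDiffAt (φ.open_source.mem_nhds hφ.mem_source)
  have hφ2 : ContMDiffAt modelS1xS3 𝓘(ℝ, Fin 2 → ℝ) ∞ (fun x => (φ x).2) p :=
    contDiff_snd.contMDiff.contMDiffAt.comp p hφp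
  have hg : ContDiffAt ℝ ∞ ((fun x => (φ x).2) ∘ transversal i Θ u) 0 :=
    (hφ2.comp (0 : ℂ) hσ.contMDiffAt).contDiffAt
  set g := (fun x => (φ x).2) ∘ transversal i Θ u with hgdef
  -- A vector killed by the transverse coordinate is pushed by the transversal into the span of `B`
  -- and `JB`. Both fields have zero component in the coordinate `j` at `p`, since that coordinate
  -- of `p` vanishes.
  have hker : ∀ v, fderiv ℝ g 0 v = 0 → v = 0 := fun v hv => by
    have h1 : MDifferentiableAt 𝓘(ℝ, ℂ) modelS1xS3 (transversal i Θ u) 0 :=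
      hσ.mdifferentiableAt (by simp)
    have h2 := mfderiv_comp_apply (0 : ℂ) (hφ2.mdifferentiableAt (by simp)) h1 v
    rw [mfderiv_eq_fderiv] at h2
    have h3 := (hφ.flat p hφ.mem_source _).2 (h2.symm.trans hv)
    obtain ⟨s, t, h4⟩ := mem_canonicalDistribution.1 h3
    rw [mfderiv_inclS1xS3_comp h1] at h4
    have h5 : HasFDerivAt (inclS1xS3 ∘ transversal i Θ u)
      (fderiv ℝ (inclS1xS3 ∘ transversal i Θ u) 0) 0 :=
      ((contDiff_transversal i Θ u).differentiable (by simp) 0).hasFDerivAt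
    have h6 : HasDerivAt (fun τ : ℝ => τ • v) v 0 := by
      simpa using (hasDerivAt_id (0 : ℝ)).smul_const v
    have h7 : HasDerivAt (fun τ : ℝ => inclS1xS3 (transversal i Θ u (τ • v)))
        (fderiv ℝ (inclS1xS3 ∘ transversal i Θ u) 0 v) 0 :=
      HasFDerivAt.comp_hasDerivAt_of_eq (0 : ℝ) h5 h6 (by simp)
    have h8 := C2_hasDerivAt_iff.1 h7.snd j
    -- At `w = 0` the normalizing factor is 1 and its derivative is multiplied by 0, so the
    -- coordinate `j` moves with velocity `v`.
    have h9 : HasDerivAt (fun τ : ℝ => (transversal i Θ u (τ • v)).2.1 j) v 0 := by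
      have h10 : DifferentiableAt ℝ (fun τ : ℝ => (((√(1 + ‖τ • v‖ ^ 2))⁻¹ : ℝ) : ℂ)) 0 :=
        (contDiff_sqrt_inv.differentiable (by simp) _).comp (0 : ℝ) h6.differentiableAt
      have h11 := h10.hasDerivAt.mul h6
      simp only [transversal_snd, if_neg hij.symm]
      exact h11.congr_deriv (by simp)
    have h10 := h9.unique h8
    rw [← h4] at h10
    have hp0 : p.2.1 j = 0 := (transversal_snd_eq_zero_iff hij).2 rfl
    rw [h10]
    simp [leeField_snd, antiLeeField_snd, hp0]
  let L : ℂ ≃L[ℝ] (Fin 2 → ℝ) := (LinearMap.linearEquivOfInjective (fderiv ℝ g 0).toLinearMap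
    ((injective_iff_map_eq_zero _).2 hker)
    (by simp [Complex.finrank_real_complex])).toContinuousLinearEquiv
  have hstrict : HasStrictFDerivAt g (L : ℂ →L[ℝ] (Fin 2 → ℝ)) 0 :=
    hg.hasStrictFDerivAt (by simp)
  have hinj : Set.InjOn g (hstrict.toOpenPartialHomeomorph g).source :=
    (hstrict.toOpenPartialHomeomorph g).injOn
  have hnhds : (hstrict.toOpenPartialHomeomorph g).source ∩ transversal i Θ u ⁻¹' φ.source ∈
      nhds (0 : ℂ) :=
    Filter.inter_mem (hstrict.toOpenPartialHomeomorph g |>.open_source.mem_nhds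
      hstrict.mem_toOpenPartialHomeomorph_source)
      (hσ.continuous.continuousAt (φ.open_source.mem_nhds hφ.mem_source))
  obtain ⟨δ, hδ, hball⟩ := Metric.mem_nhds_iff.1 hnhds
  -- The orbit of `δ / 2` stays in the disk on which `g` is injective, so its points lie in distinct
  -- slices.
  have hw : ∀ ζ : Circle, (ζ : ℂ) * (δ / 2 : ℝ) ∈ Metric.ball (0 : ℂ) δ := fun ζ => by
    rw [mem_ball_zero_iff, norm_mul, Circle.norm_coe, one_mul, Complex.norm_real, Real.norm_eq_abs,
      abs_of_pos (half_pos hδ)]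
    exact half_lt_self hδ
  have hinj' : Function.Injective fun ζ : Circle => g ((ζ : ℂ) * (δ / 2 : ℝ)) := fun ζ ζ' h =>
    Circle.ext (mul_right_cancel₀ (Complex.ofReal_ne_zero.2 (half_pos hδ).ne')
      (hinj (hball (hw ζ)).1 (hball (hw ζ')).1 h))
  refine le_trans ?_ (hN (transversal i Θ u (δ / 2 : ℝ)))
  rw [← hinj'.encard_image, sliceCount]
  refine Set.encard_le_encard ?_
  rintro _ ⟨ζ, hζ, rfl⟩
  exact ⟨_, ⟨(transversal_mem_foliationLeaf_iff hc hij).2 ⟨ζ, hζ, rfl⟩, (hball (hw ζ)).2⟩, rfl⟩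

end Slices

/-! ### Arithmetic of the holonomy group -/

section Arithmetic

variable {z w : ℂ}

lemma Circle_exp_nat_mul (n : ℕ) (x : ℝ) : Circle.exp x ^ n = Circle.exp (n * x) := by
  induction n with
  | zero => simp
  | succ n ih => rw [pow_succ, ih, ← Circle.exp_add]; push_cast; ring_nf

lemma exp_pow_eq_exp_pow_iff {m n : ℕ} : Complex.exp w ^ m = Complex.exp z ^ n ↔
    ∃ l : ℤ, (m : ℂ) * w = n * z + l * (2 * Real.pi * Complex.I) := by
  rw [← Complex.exp_nat_mul, ← Complex.exp_nat_mul, Complex.exp_eq_exp_iff_exists_int]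

/-- The return times form a lattice generated by `(0, π / Re z)` and `(1/2, Im z / (2 Re z))`.
Finite order of the first phase makes `Re w / Re z` rational; finite order of the second then
controls the imaginary parts modulo `2π`. -/
lemma exists_pow_eq_pow_of_finite_holonomy (hz : 0 < z.re) (hw : 0 < w.re)
    (h : (holonomy z w).Finite) :
    ∃ m n : ℕ, 0 < m ∧ 0 < n ∧ Complex.exp w ^ m = Complex.exp z ^ n := by
  have hpi := Real.pi_pos
  have htors : ∀ ζ ∈ holonomy z w, ∃ k : ℕ, 0 < k ∧ ζ ^ k = 1 := fun ζ hζ => by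
    refine (isOfFinOrder_iff_pow_eq_one).1 (finite_powers.1 (h.subset ?_))
    rintro _ ⟨k, rfl⟩
    exact pow_mem_holonomy hζ k
  obtain ⟨k, hk, h1⟩ := htors (phase w 0 (Real.pi / z.re))
    ⟨0, _, by simp, by
      rw [phase, Circle.exp_eq_one]
      exact ⟨-1, by field_simp; push_cast; ring⟩, rfl⟩
  obtain ⟨k', hk', h2⟩ := htors (phase w (1 / 2) (z.im / (2 * z.re)))
    ⟨1 / 2, _, by
      rw [Circle.exp_eq_one]
      exact ⟨-1, by push_cast; ring⟩, by
      rw [phase, Circle.exp_eq_one]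
      exact ⟨0, by field_simp; simp⟩, rfl⟩
  rw [phase, Circle_exp_nat_mul, Circle.exp_eq_one] at h1 h2
  obtain ⟨n, hn⟩ := h1
  obtain ⟨n', hn'⟩ := h2
  have hkr : (0 : ℝ) < k := by exact_mod_cast hk
  have hkr' : (0 : ℝ) < k' := by exact_mod_cast hk'
  have e1 : k * w.re = -n * z.re := by
    field_simp at hn
    apply mul_left_cancel₀ hpi.ne'
    linear_combination -hn
  have e2 : k' * (w.im * z.re - z.im * w.re) = n' * (2 * Real.pi) * z.re := by
    field_simp at hn'
    linarith
  have hnneg : n < 0 := by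
    have : 0 < (-n : ℝ) * z.re := by rw [← e1]; positivity
    have := pos_of_mul_pos_left this hz.le
    exact_mod_cast neg_pos.1 this
  obtain ⟨N, hN⟩ : ∃ N : ℕ, (N : ℤ) = -n := ⟨(-n).toNat, Int.toNat_of_nonneg (by omega)⟩
  have hNr : (N : ℝ) = -n := by exact_mod_cast hN
  -- Multiplying the first relation by `k'` and the second by `k` clears both denominators; `k * n'`
  -- is the resulting multiple of `2πi`.
  refine ⟨k * k', N * k', Nat.mul_pos hk hk', Nat.mul_pos (by omega) hk',
    exp_pow_eq_exp_pow_iff.2 ⟨k * n', ?_⟩⟩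
  rw [← hNr] at e1
  apply Complex.ext
  · simp
    linear_combination k' * e1
  · simp
    apply mul_right_cancel₀ hz.ne'
    linear_combination k * e2 + k' * z.im * e1

lemma encard_circle_pow_eq_one {m : ℕ} (hm : 0 < m) : {ζ : Circle | ζ ^ m = 1}.encard = m := by
  have hinj : Function.Injective fun ζ : Circle => (ζ : ℂ) := fun _ _ => Circle.ext
  suffices h : (fun ζ : Circle => (ζ : ℂ)) '' {ζ | ζ ^ m = 1} =
      (Polynomial.nthRootsFinset m (1 : ℂ) : Set ℂ) by
    rw [← hinj.encard_image, h, Set.encard_coe_eq_coe_finsetCard,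
      (Complex.isPrimitiveRoot_exp m hm.ne').card_nthRootsFinset]
  ext x
  rw [Finset.mem_coe, Polynomial.mem_nthRootsFinset hm]
  constructor
  · rintro ⟨ζ, hζ, rfl⟩
    exact_mod_cast congrArg ((↑) : Circle → ℂ) hζ
  · intro hx
    refine ⟨⟨x, mem_sphere_zero_iff_norm.2 (Complex.norm_eq_one_of_pow_eq_one hx hm.ne')⟩, ?_, rfl⟩
    exact Circle.ext ((Circle.coe_pow _ _).trans hx)

/-- If `(m, n)` is minimal with `(e^w)^m = (e^z)^n`, then the holonomy group consists of the `m`-th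
roots of unity. -/
lemma holonomy_eq (hz : 0 < z.re) {m n : ℕ} (hm : 0 < m) (hn : 0 < n)
    (h : Complex.exp w ^ m = Complex.exp z ^ n)
    (hmin : ∀ m' n' : ℕ, 0 < m' → 0 < n' → Complex.exp w ^ m' = Complex.exp z ^ n' → m ≤ m') :
    holonomy z w = {ζ | ζ ^ m = 1} := by
  have hpi := Real.pi_pos
  obtain ⟨l, hl⟩ := exp_pow_eq_exp_pow_iff.1 h
  have hre : m * w.re = n * z.re := by simpa using congrArg Complex.re hl
  have him : m * w.im = n * z.im + l * (2 * Real.pi) := by simpa using congrArg Complex.im hl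
  have hmr : (0 : ℝ) < m := by exact_mod_cast hm
  -- A common divisor of `m`, `n` and `l` could be divided out of the relation between logarithms,
  -- giving a relation with smaller `m`. So the three are coprime and Bézout applies.
  obtain ⟨x, y, v, hxyv⟩ : ∃ x y v : ℤ, x * m + y * n + v * l = 1 := by
    have e1 := Int.gcd_eq_gcd_ab m n
    have e2 := Int.gcd_eq_gcd_ab (Int.gcd m n) l
    have hdm : (Int.gcd (Int.gcd m n) l : ℤ) ∣ m :=
      (Int.gcd_dvd_left ..).trans (Int.gcd_dvd_left ..)
    have hdn : (Int.gcd (Int.gcd m n) l : ℤ) ∣ n :=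
      (Int.gcd_dvd_left ..).trans (Int.gcd_dvd_right ..)
    obtain ⟨l', hl'⟩ : (Int.gcd (Int.gcd m n) l : ℤ) ∣ l := Int.gcd_dvd_right ..
    set d := Int.gcd (Int.gcd m n) l
    obtain ⟨m', hm'⟩ := Int.natCast_dvd_natCast.1 hdm
    obtain ⟨n', hn'⟩ := Int.natCast_dvd_natCast.1 hdn
    have hd0 : 0 < d := Nat.pos_of_ne_zero fun h0 => by simp [h0] at hm'; omega
    have hm0 : 0 < m' := Nat.pos_of_ne_zero fun h0 => by simp [h0] at hm'; omega
    have hn0 : 0 < n' := Nat.pos_of_ne_zero fun h0 => by simp [h0] at hn'; omega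
    have hle : m ≤ m' := hmin m' n' hm0 hn0 (exp_pow_eq_exp_pow_iff.2 ⟨l', by
      have hdc : (d : ℂ) ≠ 0 := by exact_mod_cast hd0.ne'
      have e3 : (m : ℂ) = d * m' := by exact_mod_cast hm'
      have e4 : (n : ℂ) = d * n' := by exact_mod_cast hn'
      have e5 : (l : ℂ) = d * l' := by exact_mod_cast hl'
      rw [e3, e4, e5] at hl
      apply mul_left_cancel₀ hdc
      linear_combination hl⟩)
    have hd1 : d = 1 := by
      by_contra hne
      have : 2 ≤ d := by omega
      nlinarith
    rw [hd1, Nat.cast_one] at e2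
    exact ⟨Int.gcdA m n * Int.gcdA (Int.gcd m n) l, Int.gcdB m n * Int.gcdA (Int.gcd m n) l,
      Int.gcdB (Int.gcd m n) l, by linear_combination -e2 - Int.gcdA (Int.gcd m n) l * e1⟩
  have hxyv' : (x : ℝ) * m + y * n + v * l = 1 := by exact_mod_cast hxyv
  ext ζ
  constructor
  · rintro ⟨s, t, h0, h1, rfl⟩
    rw [Circle.exp_eq_one] at h0
    rw [phase, Circle.exp_eq_one] at h1
    obtain ⟨a, ha⟩ := h0
    obtain ⟨b, hb⟩ := h1
    change phase w s t ^ m = 1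
    rw [phase, Circle_exp_nat_mul, Circle.exp_eq_one]
    -- With `-4πs = 2πa` and angle `2πb` for `z`, the relation turns `m` times the angle for `w`
    -- into `2π(nb - la)`.
    refine ⟨n * b - l * a, ?_⟩
    push_cast
    linear_combination 2 * s * him - 2 * t * hre + n * hb - l * ha
  · intro hζ
    obtain ⟨θ, rfl⟩ := Circle.exp_surjective ζ
    change Circle.exp θ ^ m = 1 at hζ
    rw [Circle_exp_nat_mul, Circle.exp_eq_one] at hζ
    obtain ⟨h, hh⟩ := hζ
    -- These times realize `a = -hv` and `b = hy`. Then `m` times the angle for `w` is `2πh(ny + lv)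
    -- = 2πh(1 - xm)`, so the angle is `2πh / m = θ` up to the multiple `2πhx` of `2π`.
    refine ⟨h * v / 2, (h * v * z.im - 2 * Real.pi * h * y) / (2 * z.re), ?_, ?_, ?_⟩
    · rw [Circle.exp_eq_one]
      exact ⟨-(h * v), by push_cast; ring⟩
    · rw [phase, Circle.exp_eq_one]
      exact ⟨h * y, by push_cast; field_simp; ring⟩
    · rw [phase, Circle.exp_eq_exp]
      refine ⟨-(h * x), ?_⟩
      apply mul_left_cancel₀ hmr.ne'
      have e1 : (m : ℝ) * w.re = n * z.re := hre
      have e2 : (h * v * z.im - 2 * Real.pi * h * y) / (2 * z.re) * w.re * m =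
          (h * v * z.im - 2 * Real.pi * h * y) / 2 * n := by
        field_simp
        linear_combination (h * v * z.im - 2 * Real.pi * h * y) * e1
      push_cast
      linear_combination h * v * him - 2 * e2 - hh + 2 * Real.pi * h * hxyv'

end Arithmetic

/-! ### Multiplicative relations -/

/-- The relations `x ^ m = y ^ n` with positive exponents have a smallest one. -/
lemma exists_minimal_pow_eq_pow {x y : ℂ} (hx : 1 < ‖x‖) (hy : 1 < ‖y‖)
    (h : ∃ m n : ℕ, 0 < m ∧ 0 < n ∧ x ^ m = y ^ n) :
    ∃ m n : ℕ, 0 < m ∧ 0 < n ∧ x ^ m = y ^ n ∧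
      ∀ m' n' : ℕ, 0 < m' → 0 < n' → x ^ m' = y ^ n' → m ≤ m' ∧ n ≤ n' := by
  classical
  have h' : ∃ m : ℕ, 0 < m ∧ ∃ n : ℕ, 0 < n ∧ x ^ m = y ^ n := by
    obtain ⟨m, n, hm, hn, h⟩ := h; exact ⟨m, hm, n, hn, h⟩
  obtain ⟨hm, n, hn, hmn⟩ := Nat.find_spec h'
  refine ⟨Nat.find h', n, hm, hn, hmn, fun m' n' hm' hn' hmn' => ?_⟩
  have hle : Nat.find h' ≤ m' := Nat.find_min' h' ⟨hm', n', hn', hmn'⟩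
  refine ⟨hle, ?_⟩
  -- Only the first exponent was minimized. The second is an increasing function of it, because both
  -- moduli exceed 1.
  have h1 : ‖y‖ ^ n ≤ ‖y‖ ^ n' := by
    rw [← norm_pow, ← norm_pow, ← hmn, ← hmn', norm_pow, norm_pow]
    exact pow_le_pow_right₀ hx.le hle
  exact (pow_le_pow_iff_right₀ hy).1 h1

/-- Taking logarithms of moduli, which are positive, shows that the two exponents have the same sign
and that neither vanishes; negating both if necessary makes them positive. -/
lemma exists_pos_pow_eq_pow_of_zpow {x y : ℂ} (hx : 1 < ‖x‖) (hy : 1 < ‖y‖) {m n : ℤ}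
    (hne : (m, n) ≠ (0, 0)) (h : x ^ m = y ^ n) :
    ∃ m n : ℕ, 0 < m ∧ 0 < n ∧ x ^ m = y ^ n := by
  have hlog : m * Real.log ‖x‖ = n * Real.log ‖y‖ := by
    rw [← Real.log_zpow, ← Real.log_zpow, ← norm_zpow, ← norm_zpow, h]
  have hlx := Real.log_pos hx
  have hly := Real.log_pos hy
  have key : ∀ m n : ℤ, 0 < m → m * Real.log ‖x‖ = n * Real.log ‖y‖ → x ^ m = y ^ n →
      ∃ m n : ℕ, 0 < m ∧ 0 < n ∧ x ^ m = y ^ n := fun m n hm hlog h => by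
    have hmr : (0 : ℝ) < m := by exact_mod_cast hm
    have hn : 0 < n := by
      have : 0 < (n : ℝ) * Real.log ‖y‖ := by rw [← hlog]; positivity
      exact_mod_cast pos_of_mul_pos_left this hly.le
    lift m to ℕ using hm.le
    lift n to ℕ using hn.le
    exact ⟨m, n, by exact_mod_cast hm, by exact_mod_cast hn, by exact_mod_cast h⟩
  rcases lt_trichotomy m 0 with hm | rfl | hm
  · exact key (-m) (-n) (by omega) (by push_cast; linarith) (by rw [zpow_neg, zpow_neg, h])
  · have : n = 0 := by
      rw [Int.cast_zero, zero_mul, eq_comm, mul_eq_zero, or_iff_left hly.ne'] at hlog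
      exact_mod_cast hlog
    exact absurd (by rw [this]) hne
  · exact key m n hm hlog h

/-! ### Multiplicities of points -/

section Multiplicity

variable {c : Fin 2 → ℂ} {i j : Fin 2}

/-- The holonomy acts on the vanishing coordinate `j`, so the multiplicity is the exponent carried
by `exp (c j)`. -/
lemma hasMultiplicity_of_coord_eq_zero (hc : ∀ k, 0 < (c k).re) (hij : i ≠ j) {m n : ℕ}
    (hm : 0 < m) (hn : 0 < n) (h : Complex.exp (c j) ^ m = Complex.exp (c i) ^ n)
    (hmin : ∀ m' n' : ℕ, 0 < m' → 0 < n' → Complex.exp (c j) ^ m' = Complex.exp (c i) ^ n' →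
      m ≤ m') (p : S1xS3) (hp : p.2.1 j = 0) :
    HasMultiplicity modelS1xS3 2 2 (canonicalDistribution (c 0) (c 1)) p m ∧
      HasUniformChart modelS1xS3 2 2 (canonicalDistribution (c 0) (c 1)) p m := by
  have hi : p.2.1 i ≠ 0 := fun h0 => by simpa [h0, hp] using S3_normSq_of_ne hij p
  obtain ⟨Θ, u, w, rfl⟩ := exists_eq_transversal p hi
  obtain rfl := (transversal_snd_eq_zero_iff hij).1 hp
  have hH : (holonomy (c i) (c j)).encard = m := by
    rw [holonomy_eq (hc i) hm hn h hmin, encard_circle_pow_eq_one hm]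
  have hU := hasUniformChart_transversal_zero (Θ := Θ) (u := u) hc hij hH
  refine ⟨⟨mem_sliceBounds_of_hasUniformChart hc hm hU, fun N hN => ?_⟩, hU⟩
  have := encard_holonomy_le hc hij hN
  rw [hH] at this
  exact_mod_cast this

lemma hasMultiplicity_of_coord_ne_zero (hc : ∀ k, 0 < (c k).re) (hij : i ≠ j) {m n : ℕ}
    (hm : 0 < m) (hn : 0 < n) (h : Complex.exp (c j) ^ m = Complex.exp (c i) ^ n)
    (hmin : ∀ m' n' : ℕ, 0 < m' → 0 < n' → Complex.exp (c j) ^ m' = Complex.exp (c i) ^ n' →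
      m ≤ m') (p : S1xS3) (hi : p.2.1 i ≠ 0) (hj : p.2.1 j ≠ 0) :
    HasMultiplicity modelS1xS3 2 2 (canonicalDistribution (c 0) (c 1)) p 1 ∧
      HasUniformChart modelS1xS3 2 2 (canonicalDistribution (c 0) (c 1)) p 1 := by
  obtain ⟨Θ, u, w, rfl⟩ := exists_eq_transversal p hi
  have hw : w ≠ 0 := fun h0 => hj ((transversal_snd_eq_zero_iff hij).2 h0)
  have hH : (holonomy (c i) (c j)).Finite := by
    rw [← Set.encard_lt_top_iff, holonomy_eq (hc i) hm hn h hmin, encard_circle_pow_eq_one hm]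
    exact ENat.natCast_lt_top m
  have hU := hasUniformChart_transversal_of_ne (Θ := Θ) (u := u) hc hij hw hH
  exact ⟨⟨mem_sliceBounds_of_hasUniformChart hc le_rfl hU, fun N hN =>
    one_le_of_mem_sliceBounds hN⟩, hU⟩

end Multiplicity

end

theorem mainTheorem3 (α β a b : ℂ) (hβ : 1 < ‖β‖) (hαβ : ‖β‖ ≤ ‖α‖)
    (ha : Complex.exp a = α) (hb : Complex.exp b = β) :
    (IsQuasiRegular modelS1xS3 2 2 (canonicalDistribution a b) ↔
      ∃ m n : ℤ, (m, n) ≠ (0, 0) ∧ α ^ m = β ^ n) ∧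
    (IsQuasiRegular modelS1xS3 2 2 (canonicalDistribution a b) →
      ∃ m n : ℕ, 0 < m ∧ 0 < n ∧ α ^ m = β ^ n ∧
        (∀ m' n' : ℕ, 0 < m' → 0 < n' → α ^ m' = β ^ n' → m ≤ m' ∧ n ≤ n') ∧
        (∀ p : S1xS3, p.2.1 0 * p.2.1 1 ≠ 0 →
          HasMultiplicity modelS1xS3 2 2 (canonicalDistribution a b) p 1 ∧
          HasUniformChart modelS1xS3 2 2 (canonicalDistribution a b) p 1) ∧
        (∀ p : S1xS3, p.2.1 0 = 0 →
          HasMultiplicity modelS1xS3 2 2 (canonicalDistribution a b) p m ∧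
          HasUniformChart modelS1xS3 2 2 (canonicalDistribution a b) p m) ∧
        (∀ p : S1xS3, p.2.1 1 = 0 →
          HasMultiplicity modelS1xS3 2 2 (canonicalDistribution a b) p n ∧
          HasUniformChart modelS1xS3 2 2 (canonicalDistribution a b) p n)) ∧
    (IsRegularFoliation modelS1xS3 2 2 (canonicalDistribution a b) ↔ α = β) := by
  have hα : 1 < ‖α‖ := hβ.trans_le hαβ
  subst ha hb
  have hc : ∀ k, 0 < ((![a, b] : Fin 2 → ℂ) k).re := by
    rw [Complex.norm_exp, Real.one_lt_exp_iff] at hα hβ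
    simpa [Fin.forall_fin_two] using ⟨hα, hβ⟩
  have h10 : (1 : Fin 2) ≠ 0 := by decide
  have hpt : ∀ i j : Fin 2, i ≠ j → ∃ p : S1xS3, p.2.1 j = 0 := fun i j hij =>
    ⟨transversal i 1 1 0, (transversal_snd_eq_zero_iff hij).2 rfl⟩
  have hrel : IsQuasiRegular modelS1xS3 2 2 (canonicalDistribution a b) →
      ∃ m n : ℕ, 0 < m ∧ 0 < n ∧ Complex.exp a ^ m = Complex.exp b ^ n := fun hq => by
    -- A bound at one point with vanishing coordinate 0 already makes the holonomy finite and yields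
    -- the relation.
    obtain ⟨N, hN, -⟩ := hq (transversal 1 1 1 0)
    have hle := encard_holonomy_le (c := ![a, b]) hc h10 hN
    exact exists_pow_eq_pow_of_finite_holonomy (hc 1) (hc 0)
      (Set.finite_of_encard_le_coe hle)
  have hmult : (∃ m n : ℕ, 0 < m ∧ 0 < n ∧ Complex.exp a ^ m = Complex.exp b ^ n) →
      ∃ m n : ℕ, 0 < m ∧ 0 < n ∧ Complex.exp a ^ m = Complex.exp b ^ n ∧
        (∀ m' n' : ℕ, 0 < m' → 0 < n' → Complex.exp a ^ m' = Complex.exp b ^ n' →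
          m ≤ m' ∧ n ≤ n') ∧
        (∀ p : S1xS3, p.2.1 0 * p.2.1 1 ≠ 0 →
          HasMultiplicity modelS1xS3 2 2 (canonicalDistribution a b) p 1 ∧
          HasUniformChart modelS1xS3 2 2 (canonicalDistribution a b) p 1) ∧
        (∀ p : S1xS3, p.2.1 0 = 0 →
          HasMultiplicity modelS1xS3 2 2 (canonicalDistribution a b) p m ∧
          HasUniformChart modelS1xS3 2 2 (canonicalDistribution a b) p m) ∧
        (∀ p : S1xS3, p.2.1 1 = 0 →
          HasMultiplicity modelS1xS3 2 2 (canonicalDistribution a b) p n ∧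
          HasUniformChart modelS1xS3 2 2 (canonicalDistribution a b) p n) := fun h => by
    obtain ⟨m, n, hm, hn, hmn, hmin⟩ := exists_minimal_pow_eq_pow hα hβ h
    exact ⟨m, n, hm, hn, hmn, hmin,
      fun p hp => hasMultiplicity_of_coord_ne_zero (c := ![a, b]) hc h10 hm hn hmn
        (fun m' n' h1 h2 h3 => (hmin m' n' h1 h2 h3).1) p (right_ne_zero_of_mul hp)
        (left_ne_zero_of_mul hp),
      hasMultiplicity_of_coord_eq_zero (c := ![a, b]) hc h10 hm hn hmn
        fun m' n' h1 h2 h3 => (hmin m' n' h1 h2 h3).1,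
      hasMultiplicity_of_coord_eq_zero (c := ![a, b]) hc h10.symm hn hm hmn.symm
        fun n' m' h1 h2 h3 => (hmin m' n' h2 h1 h3.symm).2⟩
  have hquasi : (∃ m n : ℕ, 0 < m ∧ 0 < n ∧ Complex.exp a ^ m = Complex.exp b ^ n) →
      IsQuasiRegular modelS1xS3 2 2 (canonicalDistribution a b) := fun h p => by
    obtain ⟨m, n, -, -, -, -, h1, h2, h3⟩ := hmult h
    by_cases hp0 : p.2.1 0 = 0
    · exact ⟨m, (h2 p hp0).1⟩
    by_cases hp1 : p.2.1 1 = 0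
    · exact ⟨n, (h3 p hp1).1⟩
    exact ⟨1, (h1 p (mul_ne_zero hp0 hp1)).1⟩
  refine ⟨⟨fun hq => ?_, fun ⟨m, n, hne, h⟩ => ?_⟩, fun hq => hmult (hrel hq), fun hreg => ?_,
    fun hab p => ?_⟩
  · obtain ⟨m, n, hm, hn, h⟩ := hrel hq
    refine ⟨m, n, fun h0 => hm.ne' ?_, by exact_mod_cast h⟩
    exact Int.natCast_eq_zero.1 (congrArg Prod.fst h0)
  · exact hquasi (exists_pos_pow_eq_pow_of_zpow hα hβ hne h)
  · obtain ⟨m, n, -, -, hmn, -, -, h2, h3⟩ := hmult (hrel fun p => ⟨1, hreg p⟩)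
    obtain ⟨p, hp⟩ := hpt 1 0 h10
    obtain ⟨q, hq⟩ := hpt 0 1 h10.symm
    -- A least element is unique, so comparing multiplicities on the two exceptional circles' worth
    -- of leaves, `ξ₁ = 0` and `ξ₂ = 0`, gives `m = n = 1`.
    rw [(h2 p hp).1.unique (hreg p), (h3 q hq).1.unique (hreg q), pow_one, pow_one] at hmn
    exact hmn
  · obtain ⟨m, n, hm, hn, -, hmin, h1, h2, h3⟩ :=
      hmult ⟨1, 1, one_pos, one_pos, by rw [hab]⟩
    obtain ⟨hm1, hn1⟩ := hmin 1 1 one_pos one_pos (by rw [hab])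
    obtain rfl : m = 1 := by omega
    obtain rfl : n = 1 := by omega
    by_cases hp0 : p.2.1 0 = 0
    · exact (h2 p hp0).1
    by_cases hp1 : p.2.1 1 = 0
    · exact (h3 p hp1).1
    exact (h1 p (mul_ne_zero hp0 hp1)).1
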